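/- Let $\mathcal M$ be the topological group of real Möbius transformations $z\mapsto (az+b)/(cz+d)$, $a,b,c,d\in\mathbb R$, $ad-bc=1$, acting on the upper half-plane $\mathbb H$ and on the extended real line $\overline{\mathbb R}=\mathbb R\cup\{\infty\}$ (a topological circle). With this normalisation put $\mathrm{tr}(f)=|a+d|$. A semigroup is a nonempty subset of $\mathcal M$ closed under composition, and $\langle f,g\rangle$ denotes the semigroup (not the group) generated by $f$ and $g$. A semigroup $S$ is *elementary* if it has a finite orbit in $\mathbb H\cup\overline{\mathbb R}$, and *nonelementary* otherwise; it is *semidiscrete* if the identity is not an accumulation point of $S$ in $\mathcal M$; it is *inverse free* if no inverse of a member of $S$ lies in $S$. For hyperbolic $f$, let $\alpha_f$ and $\beta_f$ be its attracting and repelling fixed points, and for hyperbolic $f,g$ put $$C(f,g)=\frac{(\alpha_f-\alpha_g)(\beta_f-\beta_g)}{(\alpha_f-\beta_g)(\beta_f-\alpha_g)},$$ with the usual conventions about $\infty$. Let $[f,g]=fgf^{-1}g^{-1}$. A closed interval in $\overline{\mathbb R}$ is a closed arc other than a singleton or $\overline{\mathbb R}$; a map $f$ maps $J$ strictly inside itself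 if $f(J)\subset J$ and $f(J)\ne J$. A *Schottky group of rank two* is a group generated (as a group) by two elements $u,v\in\mathcal M$ for which there are pairwise disjoint nonempty open intervals $A,B,C,D$ in $\overline{\mathbb R}$ such that $u$ maps the complement of $\overline A$ onto $B$ and $v$ maps the complement of $\overline C$ onto $D$. **Theorem 1.2.** Let $f,g\in\mathcal M$ be such that $\mathrm{tr}(f)\le\mathrm{tr}(g)$ and $\langle f,g\rangle$ is nonelementary. Then $\langle f,g\rangle$ is semidiscrete and inverse free if and only if exactly one of the following holds: 1. $f$ and $g$ are parabolic, and $fg$ is not elliptic; 2. $f$ is parabolic and $g$ is hyperbolic, and $f^ng$ is not elliptic for any positive integer $n$; 3. $f$ and $g$ are hyperbolic, and either $C(f,g)<1$, or else $C(f,g)>1$, $fg$ is not elliptic, and either (a) $\mathrm{tr}[f,g]\ge\mathrm{tr}(g)^2-2$, or (b) $\mathrm{tr}[f,g]<\mathrm{tr}(g)^2-2$ and $\langle f,fg\rangle$ is semidiscrete and inverse free. Furthermore, if $\langle f,g\rangle$ is semidiscrete and inverse free, then either there is a closed interval in $\overline{\mathbb R}$ that both $f$ and $g$ map strictly inside itself,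 or else $\langle f,g\rangle$ is contained in a Schottky group of rank two. -/

import Mathlib

open scoped Topology OnePoint UpperHalfPlane MatrixGroups

namespace RealMobius

/-! The group of real Möbius transformations and its actions -/

/-- The group of real Möbius transformations `z ↦ (az+b)/(cz+d)`, normalised to `ad - bc = 1`;
a transformation determines its matrix up to sign. The topology is the quotient topology from
`SL(2, ℝ)`, that is, the topology of uniform convergence on the Riemann sphere. -/
abbrev Mob : Type := Matrix.ProjectiveSpecialLinearGroup (Fin 2) ℝ

/-- The Möbius transformation `z ↦ (az+b)/(cz+d)` with matrix `A = (a b; c d)`. -/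
abbrev ofMatrix (A : SL(2, ℝ)) : Mob := QuotientGroup.mk A

theorem center_cases {A : SL(2, ℝ)} (hA : A ∈ Subgroup.center SL(2, ℝ)) : A = 1 ∨ A = -1 := by
  obtain ⟨r, hr, h⟩ := Matrix.SpecialLinearGroup.mem_center_iff.1 hA
  rcases (show r = 1 ∨ r = -1 from by simpa using hr) with rfl | rfl
  · left
    ext i j
    fin_cases i <;> fin_cases j <;> simp [← h]
  · right
    ext i j
    fin_cases i <;> fin_cases j <;> simp [← h]

/-- The action of real Möbius transformations on the extended real line `ℝ ∪ {∞}`. -/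
noncomputable def lineHom : Mob →* Equiv.Perm (OnePoint ℝ) :=
  QuotientGroup.lift (Subgroup.center SL(2, ℝ))
    ((MulAction.toPermHom (GL (Fin 2) ℝ) (OnePoint ℝ)).comp Matrix.SpecialLinearGroup.toGL)
    (by
      intro A hA
      ext x
      rcases center_cases hA with rfl | rfl
      · simp
      · induction x using OnePoint.rec with
        | infty => simp [OnePoint.smul_infty_eq_ite]
        | coe x => simp [OnePoint.smul_some_eq_ite])

noncomputable instance : MulAction Mob (OnePoint ℝ) := MulAction.compHom _ lineHom

/-- The action of real Möbius transformations on the upper half-plane. -/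
noncomputable def planeHom : Mob →* Equiv.Perm ℍ :=
  QuotientGroup.lift (Subgroup.center SL(2, ℝ)) (MulAction.toPermHom SL(2, ℝ) ℍ)
    (by
      intro A hA
      ext x
      rcases center_cases hA with rfl | rfl
      · simp
      · change ((((-1 : SL(2, ℝ)) • x : ℍ)) : ℂ) = x
        rw [UpperHalfPlane.specialLinearGroup_apply]
        simp)

noncomputable instance : MulAction Mob ℍ := MulAction.compHom _ planeHom

theorem ofMatrix_smul_coe (A : SL(2, ℝ)) (x : ℝ) :
    ofMatrix A • (x : OnePoint ℝ) =
      if A 1 0 * x + A 1 1 = 0 then ∞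
      else (((A 0 0 * x + A 0 1) / (A 1 0 * x + A 1 1) : ℝ) : OnePoint ℝ) :=
  OnePoint.smul_some_eq_ite (g := Matrix.SpecialLinearGroup.toGL A)

theorem ofMatrix_smul_infty (A : SL(2, ℝ)) :
    ofMatrix A • (∞ : OnePoint ℝ) =
      if A 1 0 = 0 then ∞ else ((A 0 0 / A 1 0 : ℝ) : OnePoint ℝ) :=
  OnePoint.smul_infty_eq_ite (Matrix.SpecialLinearGroup.toGL A)

theorem ofMatrix_smul_plane (A : SL(2, ℝ)) (z : ℍ) : ofMatrix A • z = A • z := rfl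

/-! Trace and types of transformations -/

/-- `tr f = |a + d|`, where `f z = (az+b)/(cz+d)` with `ad - bc = 1`. -/
noncomputable def tr (f : Mob) : ℝ :=
  Quotient.liftOn' f (fun A : SL(2, ℝ) => |Matrix.trace (A : Matrix (Fin 2) (Fin 2) ℝ)|) (by
    intro A B h
    rw [QuotientGroup.leftRel_apply] at h
    have hB : B = A * (A⁻¹ * B) := by group
    rcases center_cases h with h' | h' <;> rw [h'] at hB <;> subst hB
    · simp
    · simp only [mul_neg, mul_one, Matrix.SpecialLinearGroup.coe_neg, Matrix.trace_neg, abs_neg])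

theorem tr_ofMatrix (A : SL(2, ℝ)) :
    tr (ofMatrix A) = |Matrix.trace (A : Matrix (Fin 2) (Fin 2) ℝ)| := rfl

/-- Elliptic: conjugate to a nontrivial rotation (the matrix has negative discriminant). -/
def IsElliptic (f : Mob) : Prop :=
  ∃ A : SL(2, ℝ), ofMatrix A = f ∧ (A : Matrix (Fin 2) (Fin 2) ℝ).IsElliptic

/-- Parabolic: not the identity, and the matrix has zero discriminant. -/
def IsParabolic (f : Mob) : Prop :=
  ∃ A : SL(2, ℝ), ofMatrix A = f ∧ (A : Matrix (Fin 2) (Fin 2) ℝ).IsParabolic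

/-- Hyperbolic: the matrix has positive discriminant. -/
def IsHyperbolic (f : Mob) : Prop :=
  ∃ A : SL(2, ℝ), ofMatrix A = f ∧ (A : Matrix (Fin 2) (Fin 2) ℝ).IsHyperbolic

/-! Attracting and repelling fixed points, and the cross ratio -/

/-- `p` is an attracting fixed point of `f`: the iterates of `f` converge to `p` near `p`. -/
def IsAttractingFixedPoint (f : Mob) (p : OnePoint ℝ) : Prop :=
  f • p = p ∧ ∀ᶠ x in 𝓝 p, Filter.Tendsto (fun n : ℕ => f ^ n • x) Filter.atTop (𝓝 p)

/-- The attracting fixed point `α_f` of a hyperbolic transformation. -/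
noncomputable def attr (f : Mob) : OnePoint ℝ :=
  Classical.epsilon fun p => IsAttractingFixedPoint f p

/-- The repelling fixed point `β_f`: the attracting fixed point of the inverse. -/
noncomputable def rep (f : Mob) : OnePoint ℝ := attr f⁻¹

/-- The difference `p - q`, extended to `∞` as the determinant of the homogeneous coordinates
`(x, 1)` of a real number `x` and `(1, 0)` of `∞`. In the cross ratio below, the two factors that
contain a point equal to `∞` then cancel, as they do in the limit. -/
def homDiff : OnePoint ℝ → OnePoint ℝ → ℝ
  | some x, some y => x - y
  | none, some _ => 1
  | some _, none => -1
  | none, none => 0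

/-- The cross ratio `C(f,g)` of two hyperbolic transformations without common fixed points. -/
noncomputable def crossRatio (f g : Mob) : ℝ :=
  (homDiff (attr f) (attr g) * homDiff (rep f) (rep g)) /
    (homDiff (attr f) (rep g) * homDiff (rep f) (attr g))

/-! Semigroups -/

/-- The semigroup `⟨f, g⟩` generated by `f` and `g`. -/
def semigroupGen (f g : Mob) : Subsemigroup Mob := Subsemigroup.closure {f, g}

/-- The identity is not an accumulation point of `S`. -/
def IsSemidiscrete (S : Subsemigroup Mob) : Prop :=
  ¬ AccPt (1 : Mob) (Filter.principal (S : Set Mob))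

/-- No inverse of a member of `S` lies in `S`. -/
def IsInverseFree (S : Subsemigroup Mob) : Prop := ∀ h ∈ S, h⁻¹ ∉ S

/-- `S` has a finite orbit in the union of the upper half-plane and the extended real line. -/
def IsElementary (S : Subsemigroup Mob) : Prop :=
  (∃ z : ℍ, ((fun h : Mob => h • z) '' (S : Set Mob)).Finite) ∨
    ∃ x : OnePoint ℝ, ((fun h : Mob => h • x) '' (S : Set Mob)).Finite

/-! Intervals of the extended real line, and Schottky groups -/

/-- A closed interval (arc) of the circle `ℝ ∪ {∞}`: neither a singleton nor the whole circle. -/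
def IsClosedInterval (J : Set (OnePoint ℝ)) : Prop :=
  IsClosed J ∧ IsConnected J ∧ J.Nontrivial ∧ J ≠ Set.univ

/-- An open interval (arc) of the circle `ℝ ∪ {∞}`: nonempty and not the whole circle. -/
def IsOpenInterval (U : Set (OnePoint ℝ)) : Prop :=
  IsOpen U ∧ IsConnected U ∧ U ≠ Set.univ

/-- `f` maps `J` strictly inside itself. -/
def MapsStrictlyInside (f : Mob) (J : Set (OnePoint ℝ)) : Prop :=
  (fun x => f • x) '' J ⊂ J

/-- A Schottky group of rank two: there are pairwise disjoint open intervals `A`, `B`, `C`, `D`,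
and generators `u` and `v`, such that `u` maps the complement of the closure of `A` to `B`, and `v`
maps the complement of the closure of `C` to `D`. -/
def IsSchottkyRankTwo (G : Subgroup Mob) : Prop :=
  ∃ (A B C D : Set (OnePoint ℝ)) (u v : Mob),
    IsOpenInterval A ∧ IsOpenInterval B ∧ IsOpenInterval C ∧ IsOpenInterval D ∧
    [A, B, C, D].Pairwise Disjoint ∧
    (fun x => u • x) '' (closure A)ᶜ = B ∧ (fun x => v • x) '' (closure C)ᶜ = D ∧
    G = Subgroup.closure {u, v}

/-! The three classes of pairs -/

/-- Both parabolic, and `fg` is not elliptic. -/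
def ClassOne (f g : Mob) : Prop :=
  IsParabolic f ∧ IsParabolic g ∧ ¬ IsElliptic (f * g)

/-- `f` parabolic, `g` hyperbolic, and no `fⁿg` with `n ≥ 1` is elliptic. -/
def ClassTwo (f g : Mob) : Prop :=
  IsParabolic f ∧ IsHyperbolic g ∧ ∀ n : ℕ, 0 < n → ¬ IsElliptic (f ^ n * g)

/-- Both hyperbolic, and either `C(f,g) < 1`, or `C(f,g) > 1`, `fg` is not elliptic, and either
`tr [f,g] ≥ tr(g)² - 2`, or `tr [f,g] < tr(g)² - 2` and `⟨f, fg⟩` is semidiscrete and inverse free,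
where `[f,g] = f g f⁻¹ g⁻¹`. -/
def ClassThree (f g : Mob) : Prop :=
  IsHyperbolic f ∧ IsHyperbolic g ∧
    (crossRatio f g < 1 ∨
      (1 < crossRatio f g ∧ ¬ IsElliptic (f * g) ∧
        (tr g ^ 2 - 2 ≤ tr (f * g * f⁻¹ * g⁻¹) ∨
          (tr (f * g * f⁻¹ * g⁻¹) < tr g ^ 2 - 2 ∧
            IsSemidiscrete (semigroupGen f (f * g)) ∧ IsInverseFree (semigroupGen f (f * g))))))

/-- Exactly one of three propositions holds. -/
def ExactlyOne (p q r : Prop) : Prop :=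
  (p ∧ ¬ q ∧ ¬ r) ∨ (¬ p ∧ q ∧ ¬ r) ∨ (¬ p ∧ ¬ q ∧ r)

end RealMobius

/-! Being semidiscrete and inverse free means that the identity lies outside the closure of the
semigroup. Powers of an elliptic element accumulate at the identity, so `f` and `g` may be lifted to
matrices `F`, `G` with traces `x, y ≥ 2`. Nonelementarity excludes a common fixed point, so in a
basis of leading eigenvectors `F` is upper and `G` lower triangular, with off-diagonal entries `1`
and `k ≠ 0` (`exists_normalForm`). For hyperbolic pairs `k > 0` is `C(f,g) < 1` and `k < 0` is
`C(f,g) > 1`.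

If `k > 0`, both maps send the arc of nonnegative reals and `∞` strictly inside itself, which keeps
the semigroup away from the identity.

If `k < 0`, let `z` be the trace of `F * G`. For `z ≤ -2` four explicit intervals and ping-pong give
a Schottky group. For `|z| < 2` the product is elliptic. For `z ≥ 2` pass to `f, f * g`: the group,
the sign condition and the commutator trace `δ + 2` are unchanged, while `y` is replaced by `z ≤ y -
δ / M ^ 2`, with `M` a bound for the initial traces. This Euclidean descent
(`isSchottkyBasis_of_descent`) is finite, and without elliptic products it can only stop at `z ≤
-2`. In the third class, (a) forces `z ≤ -2`, and (b) with `z ≥ 2` is the same question for the next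
pair. -/

namespace RealMobius

open Filter Set

/-! ### Homogeneous coordinates and continuity of the action -/

/-- The point of the extended real line with homogeneous coordinates `(a, b)`. -/
noncomputable def pt (a b : ℝ) : OnePoint ℝ := if b = 0 then ∞ else ((a / b : ℝ) : OnePoint ℝ)

theorem pt_one (x : ℝ) : pt x 1 = (x : OnePoint ℝ) := by simp [pt]

theorem pt_zero (x : ℝ) : pt x 0 = ∞ := by simp [pt]

theorem pt_mul {t : ℝ} (ht : t ≠ 0) (a b : ℝ) : pt (t * a) (t * b) = pt a b := by
  by_cases hb : b = 0
  · simp [pt, hb]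
  · simp [pt, hb, ht, mul_div_mul_left]

theorem exists_pt (x : OnePoint ℝ) : ∃ a b, (a ≠ 0 ∨ b ≠ 0) ∧ x = pt a b := by
  induction x using OnePoint.rec with
  | infty => exact ⟨1, 0, by simp, by simp [pt]⟩
  | coe x => exact ⟨x, 1, by simp, (pt_one x).symm⟩

theorem pt_eq_pt {a b c d : ℝ} (h : a ≠ 0 ∨ b ≠ 0) (h' : c ≠ 0 ∨ d ≠ 0) :
    pt a b = pt c d ↔ a * d = b * c := by
  by_cases hb : b = 0 <;> by_cases hd : d = 0 <;> simp_all [pt]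
  rw [div_eq_div_iff hb hd]
  constructor <;> intro h <;> linarith

theorem gl_smul_pt (K : GL (Fin 2) ℝ) {a b : ℝ} (h : a ≠ 0 ∨ b ≠ 0) :
    K • pt a b = pt (K 0 0 * a + K 0 1 * b) (K 1 0 * a + K 1 1 * b) := by
  by_cases hb : b = 0
  · subst hb
    have ha : a ≠ 0 := by simpa using h
    rw [pt_zero, OnePoint.smul_infty_eq_ite]
    by_cases hc : K 1 0 = 0
    · simp [pt, hc]
    · simp [pt, hc, ha, mul_div_mul_right]
  · rw [pt, if_neg hb, OnePoint.smul_some_eq_ite]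
    have e : K 1 0 * (a / b) + K 1 1 = (K 1 0 * a + K 1 1 * b) / b := by field_simp
    have e' : K 0 0 * (a / b) + K 0 1 = (K 0 0 * a + K 0 1 * b) / b := by field_simp
    rw [e, e', pt]
    simp only [div_eq_zero_iff, hb, or_false]
    split_ifs
    · rfl
    · rw [div_div_div_cancel_right₀ hb]

theorem ofMatrix_smul (A : SL(2, ℝ)) (x : OnePoint ℝ) :
    ofMatrix A • x = Matrix.SpecialLinearGroup.toGL A • x := rfl

theorem ofMatrix_smul_pt (A : SL(2, ℝ)) {a b : ℝ} (h : a ≠ 0 ∨ b ≠ 0) :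
    ofMatrix A • pt a b = pt (A 0 0 * a + A 0 1 * b) (A 1 0 * a + A 1 1 * b) :=
  gl_smul_pt (Matrix.SpecialLinearGroup.toGL A) h

theorem gl_apply_ne_zero (K : GL (Fin 2) ℝ) {a b : ℝ} (h : a ≠ 0 ∨ b ≠ 0) :
    K 0 0 * a + K 0 1 * b ≠ 0 ∨ K 1 0 * a + K 1 1 * b ≠ 0 := by
  by_contra! hc
  have hd : K 0 0 * K 1 1 - K 0 1 * K 1 0 ≠ 0 := by
    have := K.det_ne_zero
    rwa [Matrix.det_fin_two] at this
  have h1 : a * (K 0 0 * K 1 1 - K 0 1 * K 1 0) = 0 := by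
    linear_combination K 1 1 * hc.1 - K 0 1 * hc.2
  have h2 : b * (K 0 0 * K 1 1 - K 0 1 * K 1 0) = 0 := by
    linear_combination K 0 0 * hc.2 - K 1 0 * hc.1
  simp_all

theorem tendsto_pt {ι : Type*} {l : Filter ι} {u v : ι → ℝ} {a b : ℝ} (hu : Tendsto u l (𝓝 a))
    (hv : Tendsto v l (𝓝 b)) (h : a ≠ 0 ∨ b ≠ 0) :
    Tendsto (fun i => pt (u i) (v i)) l (𝓝 (pt a b)) := by
  by_cases hb : b = 0
  · subst hb
    have ha : a ≠ 0 := by simpa using h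
    rw [pt_zero, OnePoint.hasBasis_nhds_infty.tendsto_right_iff]
    rintro s ⟨-, hs⟩
    obtain ⟨R, hR⟩ := hs.isBounded.exists_norm_le
    have h1 : Tendsto (fun i => |v i| * R - |u i|) l (𝓝 (|0| * R - |a|)) :=
      (hv.abs.mul_const R).sub hu.abs
    have h2 : |(0 : ℝ)| * R - |a| < 0 := by simpa using ha
    filter_upwards [h1.eventually (gt_mem_nhds h2)] with i hi
    by_cases hvi : v i = 0
    · right; simp [pt, hvi]
    · left
      refine ⟨u i / v i, ?_, by simp [pt, hvi]⟩
      intro hm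
      have := hR _ hm
      rw [Real.norm_eq_abs, abs_div, div_le_iff₀ (abs_pos.2 hvi)] at this
      linarith [mul_comm R |v i|]
  · have h1 : Tendsto (fun i => ((u i / v i : ℝ) : OnePoint ℝ)) l (𝓝 ((a / b : ℝ) : OnePoint ℝ)) :=
      (OnePoint.continuous_coe.tendsto _).comp (hu.div hv hb)
    have e : pt a b = ((a / b : ℝ) : OnePoint ℝ) := by simp [pt, hb]
    rw [e]
    refine h1.congr' ?_
    filter_upwards [hv.eventually_ne hb] with i hi
    simp [pt, hi]

/-- The action is linear in homogeneous coordinates, so `tendsto_pt` applies everywhere; near `∞`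
the coordinates `(1, x⁻¹)` replace `(x, 1)`. -/
theorem continuous_gl_smul (K : GL (Fin 2) ℝ) : Continuous fun x : OnePoint ℝ => K • x := by
  rw [continuous_iff_continuousAt]
  intro x
  induction x using OnePoint.rec with
  | coe x =>
    rw [OnePoint.continuousAt_coe]
    have e : (fun x : OnePoint ℝ => K • x) ∘ ((↑) : ℝ → OnePoint ℝ) =
        fun x => pt (K 0 0 * x + K 0 1 * 1) (K 1 0 * x + K 1 1 * 1) := by
      ext1 x
      simp only [Function.comp_apply, ← pt_one]
      rw [gl_smul_pt K (by simp)]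
    rw [ContinuousAt, e]
    exact tendsto_pt ((continuous_const.mul continuous_id).add continuous_const).continuousAt
      ((continuous_const.mul continuous_id).add continuous_const).continuousAt
      (gl_apply_ne_zero K (by simp))
  | infty =>
    rw [OnePoint.continuousAt_infty']
    have e : K • (∞ : OnePoint ℝ) = pt (K 0 0 * 1 + K 0 1 * 0) (K 1 0 * 1 + K 1 1 * 0) := by
      rw [← pt_zero 1, gl_smul_pt K (by simp)]
    have hi : Tendsto (fun x : ℝ => x⁻¹) (coclosedCompact ℝ) (𝓝 0) := by
      rw [coclosedCompact_eq_cocompact, ← Metric.cobounded_eq_cocompact]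
      exact tendsto_inv₀_cobounded
    have h0 : ∀ᶠ x : ℝ in coclosedCompact ℝ, x ≠ 0 := by
      rw [coclosedCompact_eq_cocompact]
      exact (isCompact_singleton (x := (0 : ℝ))).compl_mem_cocompact
    rw [e]
    refine (tendsto_pt (tendsto_const_nhds.add (tendsto_const_nhds.mul hi))
      (tendsto_const_nhds.add (tendsto_const_nhds.mul hi)) (gl_apply_ne_zero K (by simp))).congr' ?_
    filter_upwards [h0] with x hx
    rw [Function.comp_apply, ← pt_one, gl_smul_pt K (by simp), ← pt_mul hx]
    congr 1 <;> field_simp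

/-- The homeomorphism of the extended real line given by an invertible matrix. -/
noncomputable def glHomeo (K : GL (Fin 2) ℝ) : OnePoint ℝ ≃ₜ OnePoint ℝ where
  toEquiv := MulAction.toPerm K
  continuous_toFun := continuous_gl_smul K
  continuous_invFun := continuous_gl_smul K⁻¹

theorem continuous_smul_const (x : OnePoint ℝ) : Continuous fun h : Mob => h • x := by
  obtain ⟨a, b, hab, rfl⟩ := exists_pt x
  refine QuotientGroup.isOpenQuotientMap_mk.isQuotientMap.continuous_iff.2 ?_
  rw [continuous_iff_continuousAt]
  intro A
  have e : (fun h : Mob => h • pt a b) ∘ (QuotientGroup.mk : SL(2, ℝ) → Mob) =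
      fun A : SL(2, ℝ) => pt (A 0 0 * a + A 0 1 * b) (A 1 0 * a + A 1 1 * b) := by
    ext1 A
    exact ofMatrix_smul_pt A hab
  rw [ContinuousAt, e]
  have hc : ∀ i j : Fin 2, Continuous fun A : SL(2, ℝ) => A i j := fun i j =>
    (continuous_apply_apply i j).comp continuous_subtype_val
  exact tendsto_pt (((hc 0 0).mul continuous_const).add ((hc 0 1).mul continuous_const)).continuousAt
    (((hc 1 0).mul continuous_const).add ((hc 1 1).mul continuous_const)).continuousAt
    (gl_apply_ne_zero (Matrix.SpecialLinearGroup.toGL A) hab)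

theorem continuous_smul_line (f : Mob) : Continuous fun x : OnePoint ℝ => f • x := by
  induction f using QuotientGroup.induction_on with
  | H A => exact continuous_gl_smul (Matrix.SpecialLinearGroup.toGL A)

/-! Semigroups whose closure avoids the identity -/

/-- Since `h * h⁻¹ = 1` and `1⁻¹ = 1`, inverse free means `1 ∉ S`; then deleting `1` from `S`
changes nothing and accumulation is membership in the closure. -/
theorem semidiscrete_inverseFree_iff (S : Subsemigroup Mob) :
    IsSemidiscrete S ∧ IsInverseFree S ↔ (1 : Mob) ∉ closure (S : Set Mob) := by
  have h1 : IsInverseFree S ↔ (1 : Mob) ∉ S := by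
    constructor
    · intro h h1
      exact h 1 h1 (by simpa using h1)
    · intro h x hx hx'
      exact h (by simpa using S.mul_mem hx hx')
  rw [h1, IsSemidiscrete, accPt_principal_iff_clusterPt, ← mem_closure_iff_clusterPt]
  constructor
  · rintro ⟨h, h'⟩
    rwa [Set.sdiff_singleton_eq_self (by simpa using h')] at h
  · intro h
    exact ⟨fun h' => h (closure_mono Set.sdiff_subset h'), fun h' => h (subset_closure h')⟩

theorem semigroupGen_comm (f g : Mob) : semigroupGen f g = semigroupGen g f := by
  rw [semigroupGen, semigroupGen, Set.pair_comm]

theorem left_mem_semigroupGen (f g : Mob) : f ∈ semigroupGen f g :=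
  Subsemigroup.subset_closure (by simp)

theorem right_mem_semigroupGen (f g : Mob) : g ∈ semigroupGen f g :=
  Subsemigroup.subset_closure (by simp)

theorem semigroupGen_mul_le (f g : Mob) : semigroupGen f (f * g) ≤ semigroupGen f g := by
  rw [semigroupGen, Subsemigroup.closure_le]
  rintro x (rfl | rfl)
  · exact left_mem_semigroupGen _ _
  · exact mul_mem (left_mem_semigroupGen _ _) (right_mem_semigroupGen _ _)

theorem pow_mem_subsemigroup {S : Subsemigroup Mob} {f : Mob} (hf : f ∈ S) {n : ℕ} (hn : n ≠ 0) :
    f ^ n ∈ S := by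
  induction n with
  | zero => exact absurd rfl hn
  | succ n ih =>
    rcases eq_or_ne n 0 with rfl | h
    · simpa using hf
    · rw [pow_succ]
      exact S.mul_mem (ih h) hf

/-- By its first letter, each element sends `J` into `f(J)` or into `g(J)`. Each image misses a
point of `J`, and a map near the identity keeps these two points outside the closed sets `f(J)` and
`g(J)`. -/
theorem one_notMem_closure_of_mapsStrictlyInside {f g : Mob} {J : Set (OnePoint ℝ)}
    (hJ : IsClosed J) (hf : MapsStrictlyInside f J) (hg : MapsStrictlyInside g J) :
    (1 : Mob) ∉ closure (semigroupGen f g : Set Mob) := by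
  obtain ⟨hf1, x, hxJ, hx⟩ := Set.ssubset_iff_exists.1 hf
  obtain ⟨hg1, y, hyJ, hy⟩ := Set.ssubset_iff_exists.1 hg
  have key : ∀ h ∈ semigroupGen f g, ((fun x => h • x) '' J ⊆ (fun x => f • x) '' J ∨
      (fun x => h • x) '' J ⊆ (fun x => g • x) '' J) := by
    intro h hh
    induction hh using Subsemigroup.closure_induction with
    | mem a ha =>
      rcases ha with rfl | rfl
      · exact .inl subset_rfl
      · exact .inr subset_rfl
    | mul a b ha hb iha ihb =>
      have hbJ : (fun x => b • x) '' J ⊆ J :=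
        ihb.elim (fun h => h.trans hf1) (fun h => h.trans hg1)
      have : (fun x => (a * b) • x) '' J ⊆ (fun x => a • x) '' J := by
        rintro _ ⟨z, hz, rfl⟩
        exact ⟨b • z, hbJ ⟨z, hz, rfl⟩, (mul_smul a b z).symm⟩
      exact iha.imp this.trans this.trans
  have hcl : ∀ h : Mob, IsClosed ((fun x : OnePoint ℝ => h • x) '' J) := fun h =>
    (hJ.isCompact.image (continuous_smul_line h)).isClosed
  intro h1
  have hU : {h : Mob | h • x ∉ (fun x => f • x) '' J ∧ h • y ∉ (fun x => g • x) '' J} ∈ 𝓝 (1 : Mob) := by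
    refine IsOpen.mem_nhds (IsOpen.inter ?_ ?_) ?_
    · exact (hcl f).isOpen_compl.preimage (continuous_smul_const x)
    · exact (hcl g).isOpen_compl.preimage (continuous_smul_const y)
    · simpa using ⟨by simpa using hx, by simpa using hy⟩
  obtain ⟨h, ⟨hh1, hh2⟩, hS⟩ := mem_closure_iff_nhds.1 h1 _ hU
  rcases key h hS with hk | hk
  · exact hh1 (hk ⟨x, hxJ, rfl⟩)
  · exact hh2 (hk ⟨y, hyJ, rfl⟩)

/-! Types of transformations in terms of the trace -/

theorem ofMatrix_neg (A : SL(2, ℝ)) : ofMatrix (-A) = ofMatrix A := by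
  refine QuotientGroup.eq.2 ?_
  rw [Matrix.SpecialLinearGroup.mem_center_iff]
  refine ⟨-1, by simp, ?_⟩
  have : (-A)⁻¹ * A = -1 := by
    rw [inv_mul_eq_iff_eq_mul]
    simp
  rw [this]
  ext i j
  fin_cases i <;> fin_cases j <;> simp

/-- Once the signs of the lifts are fixed in this way, the sign of the trace of a product of lifts
becomes meaningful. -/
theorem exists_lift (f : Mob) : ∃ F : SL(2, ℝ), ofMatrix F = f ∧ F 0 0 + F 1 1 = tr f := by
  induction f using QuotientGroup.induction_on with
  | H A =>
    rcases le_total 0 (A 0 0 + A 1 1) with h | h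
    · exact ⟨A, rfl, by rw [tr_ofMatrix, Matrix.trace_fin_two, abs_of_nonneg h]⟩
    · refine ⟨-A, ofMatrix_neg A, ?_⟩
      rw [tr_ofMatrix, Matrix.trace_fin_two, abs_of_nonpos h]
      simp
      ring

theorem det_eq_one (A : SL(2, ℝ)) : A 0 0 * A 1 1 - A 0 1 * A 1 0 = 1 := by
  have := A.det_coe
  rwa [Matrix.det_fin_two] at this

theorem tr_ofMatrix' (A : SL(2, ℝ)) : tr (ofMatrix A) = |A 0 0 + A 1 1| := by
  rw [tr_ofMatrix, Matrix.trace_fin_two]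

theorem tr_nonneg (f : Mob) : 0 ≤ tr f := by
  induction f using QuotientGroup.induction_on with
  | H A => exact abs_nonneg _

theorem discr_eq (A : SL(2, ℝ)) :
    (A : Matrix (Fin 2) (Fin 2) ℝ).discr = tr (ofMatrix A) ^ 2 - 4 := by
  rw [Matrix.discr_fin_two, tr_ofMatrix, sq_abs, A.det_coe]
  ring

theorem isElliptic_iff {f : Mob} : IsElliptic f ↔ tr f < 2 := by
  have h0 := tr_nonneg f
  constructor
  · rintro ⟨A, rfl, hA⟩
    rw [Matrix.IsElliptic, discr_eq] at hA
    nlinarith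
  · intro h
    obtain ⟨F, rfl, -⟩ := exists_lift f
    refine ⟨F, rfl, ?_⟩
    rw [Matrix.IsElliptic, discr_eq]
    nlinarith

theorem isHyperbolic_iff {f : Mob} : IsHyperbolic f ↔ 2 < tr f := by
  have h0 := tr_nonneg f
  constructor
  · rintro ⟨A, rfl, hA⟩
    rw [Matrix.IsHyperbolic, discr_eq] at hA
    nlinarith
  · intro h
    obtain ⟨F, rfl, -⟩ := exists_lift f
    refine ⟨F, rfl, ?_⟩
    rw [Matrix.IsHyperbolic, discr_eq]
    nlinarith

theorem isParabolic_iff {f : Mob} : IsParabolic f ↔ f ≠ 1 ∧ tr f = 2 := by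
  have h0 := tr_nonneg f
  constructor
  · rintro ⟨A, rfl, hA, hd⟩
    rw [discr_eq] at hd
    refine ⟨?_, by nlinarith⟩
    intro h
    have hc : A ∈ Subgroup.center SL(2, ℝ) := (QuotientGroup.eq_one_iff A).1 h
    apply hA
    rcases center_cases hc with rfl | rfl
    · exact ⟨1, by simp⟩
    · refine ⟨-1, ?_⟩
      ext i j
      fin_cases i <;> fin_cases j <;> simp
  · rintro ⟨h1, h2⟩
    obtain ⟨F, rfl, -⟩ := exists_lift f
    refine ⟨F, rfl, ?_, by rw [discr_eq, h2]; norm_num⟩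
    rintro ⟨r, hr⟩
    apply h1
    refine (QuotientGroup.eq_one_iff F).2 ?_
    rw [Matrix.SpecialLinearGroup.mem_center_iff]
    refine ⟨r, ?_, hr⟩
    have := F.det_coe
    rw [← hr] at this
    simpa using this

/-! Elliptic transformations generate semigroups accumulating at the identity -/

/-- Write `A = c + s J` with `J ^ 2 = -1` and `c ^ 2 + s ^ 2 = 1`; sending `i` to `J` embeds the
unit circle as a compact subgroup through `A`. -/
theorem exists_circle_hom {A : SL(2, ℝ)} (hA : (A 0 0 + A 1 1) ^ 2 < 4) :
    ∃ φ : Circle →* SL(2, ℝ), Continuous φ ∧ A ∈ Set.range φ := by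
  have hd := det_eq_one A
  set c := (A 0 0 + A 1 1) / 2 with hc
  have hc1 : 0 < 1 - c ^ 2 := by rw [hc]; nlinarith
  clear_value c
  set s := √(1 - c ^ 2) with hs
  have hs2 : s ^ 2 = 1 - c ^ 2 := Real.sq_sqrt hc1.le
  have hs0 : s ≠ 0 := (Real.sqrt_pos.2 hc1).ne'
  have ha : A 0 0 = c + (A 0 0 - A 1 1) / 2 := by rw [hc]; ring
  have ha' : A 1 1 = c - (A 0 0 - A 1 1) / 2 := by rw [hc]; ring
  obtain ⟨p, q, r, hp, hq, hr⟩ : ∃ p q r : ℝ, s * p = (A 0 0 - A 1 1) / 2 ∧ s * q = A 0 1 ∧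
      s * r = A 1 0 :=
    ⟨(A 0 0 - A 1 1) / 2 / s, A 0 1 / s, A 1 0 / s, by field_simp, by field_simp, by field_simp⟩
  have hpqr : p ^ 2 + q * r = -1 := by
    have : s ^ 2 * (p ^ 2 + q * r) = s ^ 2 * (-1) := by
      rw [← hp] at ha ha'
      rw [ha, ha', ← hq, ← hr] at hd
      linear_combination -hd + hs2
    exact mul_left_cancel₀ (pow_ne_zero 2 hs0) this
  set J : Matrix (Fin 2) (Fin 2) ℝ := !![p, q; r, -p] with hJ
  have hJJ : J * J = -1 := by
    ext i j
    fin_cases i <;> fin_cases j <;> simp [hJ] <;> first | linear_combination hpqr | ring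
  have happ : ∀ z : ℂ, Complex.liftAux J hJJ z =
      !![z.re + z.im * p, z.im * q; z.im * r, z.re - z.im * p] := by
    intro z
    rw [Complex.liftAux_apply]
    ext i j
    fin_cases i <;> fin_cases j <;>
      simp [hJ, Matrix.algebraMap_matrix_apply] <;> ring
  have hdet : ∀ z : Circle, (Complex.liftAux J hJJ z).det = 1 := by
    intro z
    have hz : (z : ℂ).re ^ 2 + (z : ℂ).im ^ 2 = 1 := by
      have := Circle.normSq_coe z
      rw [Complex.normSq_apply] at this
      linear_combination this
    rw [happ, Matrix.det_fin_two_of]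
    linear_combination hz - (z : ℂ).im ^ 2 * hpqr
  refine ⟨{ toFun := fun z => ⟨Complex.liftAux J hJJ z, hdet z⟩
            map_one' := by ext1; simp
            map_mul' := fun z w => Subtype.ext (by
              change Complex.liftAux J hJJ ((z * w : Circle) : ℂ) = _ * _
              rw [Circle.coe_mul, map_mul]) }, ?_, ?_⟩
  · refine Continuous.subtype_mk ?_ _
    simp only [happ]
    refine continuous_matrix fun i j => ?_
    fin_cases i <;> fin_cases j <;> (simp; fun_prop)
  · have hz : ‖(⟨c, s⟩ : ℂ)‖ = 1 := by
      rw [← sq_eq_sq₀ (norm_nonneg _) zero_le_one, Complex.sq_norm, Complex.normSq_apply]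
      simp only
      linear_combination hs2
    refine ⟨⟨⟨c, s⟩, by simpa [Submonoid.unitSphere] using hz⟩, ?_⟩
    ext i j
    change Complex.liftAux J hJJ ⟨c, s⟩ i j = A i j
    rw [happ]
    fin_cases i <;> fin_cases j <;> simp
    · linear_combination hp - ha
    · exact hq
    · exact hr
    · linear_combination -hp - ha'

theorem one_mem_closure_of_isElliptic {S : Subsemigroup Mob} {f : Mob} (hf : f ∈ S)
    (he : IsElliptic f) : (1 : Mob) ∈ closure (S : Set Mob) := by
  obtain ⟨A, rfl, hA⟩ := he
  rw [Matrix.IsElliptic, Matrix.discr_fin_two, A.det_coe, Matrix.trace_fin_two] at hA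
  obtain ⟨φ, hφ, z, rfl⟩ := exists_circle_hom (A := A) (by linarith)
  have h1 : MapClusterPt (ofMatrix (φ 1)) atTop ((fun w => ofMatrix (φ w)) ∘ (z ^ · : ℕ → Circle)) :=
    (mapClusterPt_one_atTop_pow z).continuousAt_comp (f := fun w => ofMatrix (φ w))
      (QuotientGroup.continuous_mk.comp hφ).continuousAt
  rw [map_one] at h1
  rw [mem_closure_iff_clusterPt]
  refine ClusterPt.mono h1 ?_
  rw [le_principal_iff, mem_map]
  -- The zeroth power is discarded: a semigroup need not contain `1`.
  filter_upwards [eventually_ne_atTop 0] with n hn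
  have : ofMatrix (φ (z ^ n)) = ofMatrix (φ z) ^ n := by rw [map_pow]; rfl
  simp only [mem_preimage, Function.comp_apply, this]
  exact pow_mem_subsemigroup hf hn

/-! Schottky pairs and ping-pong -/

/-- The intervals `A`, `B`, `C`, `D` exhibit `u` and `v` as generators of a Schottky group. -/
structure IsSchottkySystem (u v : Mob) (A B C D : Set (OnePoint ℝ)) : Prop where
  interval_A : IsOpenInterval A
  interval_B : IsOpenInterval B
  interval_C : IsOpenInterval C
  interval_D : IsOpenInterval D
  pairwise_disjoint : [A, B, C, D].Pairwise Disjoint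
  image_compl_A : (fun x => u • x) '' (closure A)ᶜ = B
  image_A : (fun x => u • x) '' A = (closure B)ᶜ
  image_compl_C : (fun x => v • x) '' (closure C)ᶜ = D
  image_C : (fun x => v • x) '' C = (closure D)ᶜ

/-- The pair `f`, `g` freely generates a group in which `1` is isolated. -/
def FreelyDiscrete (f g : Mob) : Prop :=
  ∃ U ∈ 𝓝 (1 : Mob), ∀ w : FreeGroup Bool, w ≠ 1 → FreeGroup.lift (fun b => cond b f g) w ∉ U

theorem IsOpenInterval.image {A : Set (OnePoint ℝ)} (hA : IsOpenInterval A)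
    (φ : OnePoint ℝ ≃ₜ OnePoint ℝ) : IsOpenInterval (φ '' A) :=
  ⟨φ.isOpenMap _ hA.1, hA.2.1.image _ φ.continuous.continuousOn, fun h =>
    hA.2.2 (by rwa [← Set.image_univ_of_surjective φ.surjective, φ.injective.image_injective.eq_iff]
      at h)⟩

theorem IsSchottkySystem.conj {u v u' v' : Mob} {A B C D : Set (OnePoint ℝ)}
    (h : IsSchottkySystem u v A B C D) (φ : OnePoint ℝ ≃ₜ OnePoint ℝ)
    (hu : ∀ x, φ (u • x) = u' • φ x) (hv : ∀ x, φ (v • x) = v' • φ x) :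
    IsSchottkySystem u' v' (φ '' A) (φ '' B) (φ '' C) (φ '' D) := by
  have key : ∀ {w w' : Mob} {X Y : Set (OnePoint ℝ)}, (∀ x, φ (w • x) = w' • φ x) →
      (fun x => w • x) '' X = Y → (fun x => w' • x) '' (φ '' X) = φ '' Y := by
    rintro w w' X Y hw rfl
    rw [Set.image_image, Set.image_image]
    simp only [hw]
  refine ⟨h.interval_A.image φ, h.interval_B.image φ, h.interval_C.image φ, h.interval_D.image φ,
    ?_, ?_, ?_, ?_, ?_⟩
  · have := h.pairwise_disjoint
    simp only [List.pairwise_cons, List.mem_cons, List.not_mem_nil, or_false, forall_eq_or_imp,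
      forall_eq, Set.disjoint_image_iff φ.injective] at this ⊢
    simpa using this
  all_goals rw [← φ.image_closure, ← Set.image_compl_eq φ.bijective]
  · exact key hu h.image_compl_A
  · exact key hu h.image_A
  · exact key hv h.image_compl_C
  · exact key hv h.image_C

theorem IsSchottkySystem.isSchottkyRankTwo {u v : Mob} {A B C D : Set (OnePoint ℝ)}
    (h : IsSchottkySystem u v A B C D) : IsSchottkyRankTwo (Subgroup.closure {u, v}) :=
  ⟨A, B, C, D, u, v, h.interval_A, h.interval_B, h.interval_C, h.interval_D, h.pairwise_disjoint,
    h.image_compl_A, h.image_compl_C, rfl⟩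

/-- Ping-pong. A letter sends the exterior of the interval of its inverse into its own interval, so
a reduced word beginning with `x` sends everything outside one closed interval into `I x`. Maps near
the identity keep a chosen point of each interval inside that interval. -/
theorem IsSchottkySystem.freelyDiscrete {u v : Mob} {A B C D : Set (OnePoint ℝ)}
    (h : IsSchottkySystem u v A B C D) : FreelyDiscrete u v := by
  let I : Bool × Bool → Set (OnePoint ℝ) := fun x =>
    match x with
    | (true, true) => B
    | (true, false) => A
    | (false, true) => D
    | (false, false) => C
  let L : Bool × Bool → Mob := fun x => cond x.2 (cond x.1 u v) (cond x.1 u v)⁻¹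
  have hopen : ∀ x, IsOpenInterval (I x) := by
    rintro ⟨_ | _, _ | _⟩
    exacts [h.interval_C, h.interval_D, h.interval_A, h.interval_B]
  have hdisj : ∀ x y, x ≠ y → Disjoint (I x) (I y) := by
    have := h.pairwise_disjoint
    simp only [List.pairwise_cons, List.mem_cons, List.not_mem_nil, or_false, forall_eq_or_imp,
      forall_eq] at this
    obtain ⟨⟨h1, h2, h3⟩, ⟨h4, h5⟩, h6, -⟩ := this
    rintro ⟨_ | _, _ | _⟩ ⟨_ | _, _ | _⟩ hne <;> first | exact absurd rfl hne | skip
    exacts [h6, h2.symm, h4.symm, h6.symm, h3.symm, h5.symm, h2, h3, h1, h4, h5, h1.symm]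
  have hdisj' : ∀ x y, x ≠ y → ∀ p ∈ I x, p ∉ closure (I y) := fun x y hxy p hp hp' =>
    Set.disjoint_left.1 ((hdisj x y hxy).closure_right (hopen x).1) hp hp'
  have hinv : ∀ {w : Mob} {X Y : Set (OnePoint ℝ)}, (fun x => w • x) '' X = Yᶜ → ∀ p, p ∉ Y →
      w⁻¹ • p ∈ X := by
    intro w X Y hw p hp
    obtain ⟨q, hq, rfl⟩ : p ∈ (fun x => w • x) '' X := by rw [hw]; exact hp
    simpa using hq
  have hstep : ∀ x p, p ∉ closure (I (x.1, !x.2)) → L x • p ∈ I x := by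
    rintro ⟨_ | _, _ | _⟩ p hp
    · exact hinv h.image_C p hp
    · exact h.image_compl_C.subset ⟨p, hp, rfl⟩
    · exact hinv h.image_A p hp
    · exact h.image_compl_A.subset ⟨p, hp, rfl⟩
  have hword : ∀ (l : List (Bool × Bool)) (x : Bool × Bool), FreeGroup.IsReduced (x :: l) →
      ∃ y : Bool × Bool, ∀ p, p ∉ closure (I y) → ((x :: l).map L).prod • p ∈ I x := by
    intro l
    induction l with
    | nil =>
      intro x _
      exact ⟨(x.1, !x.2), fun p hp => by simpa using hstep x p hp⟩
    | cons z l ih =>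
      intro x hx
      obtain ⟨hxz, hz⟩ := List.isChain_cons_cons.1 hx
      obtain ⟨y, hy⟩ := ih z hz
      refine ⟨y, fun p hp => ?_⟩
      rw [List.map_cons, List.prod_cons, mul_smul]
      refine hstep x _ (hdisj' z _ ?_ _ (hy p hp))
      rintro rfl
      simp at hxz
  have hne : ∀ x, (I x).Nonempty := fun x => (hopen x).2.1.nonempty
  choose P hP using hne
  refine ⟨⋂ x, {k : Mob | k • P x ∈ I x}, ?_, ?_⟩
  · refine Filter.iInter_mem.2 fun x => IsOpen.mem_nhds
      ((hopen x).1.preimage (continuous_smul_const _)) ?_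
    simpa using hP x
  · intro w hw hU
    have hl : FreeGroup.lift (fun b => cond b u v) w = (w.toWord.map L).prod := by
      conv_lhs => rw [← FreeGroup.mk_toWord (x := w), FreeGroup.lift_mk]
    have hr : FreeGroup.IsReduced w.toWord := FreeGroup.isReduced_toWord
    rw [hl] at hU
    cases hw' : w.toWord with
    | nil => exact hw (FreeGroup.toWord_eq_nil_iff.1 hw')
    | cons x l =>
      rw [hw'] at hU hr
      obtain ⟨y, hy⟩ := hword l x hr
      -- With four intervals there is one other than the target `I x` and the excluded `I y`; the
      -- word moves its base point out of it.
      obtain ⟨z, hzx, hzy⟩ : ∃ z, z ≠ x ∧ z ≠ y :=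
        (by decide : ∀ x y : Bool × Bool, ∃ z, z ≠ x ∧ z ≠ y) x y
      have h1 := hy (P z) (hdisj' z y hzy _ (hP z))
      exact Set.disjoint_left.1 (hdisj z x hzx) (Set.mem_iInter.1 hU z) h1

theorem FreelyDiscrete.one_notMem_closure {f g : Mob} (h : FreelyDiscrete f g) :
    (1 : Mob) ∉ closure (semigroupGen f g : Set Mob) := by
  obtain ⟨U, hU, hw⟩ := h
  intro h1
  obtain ⟨k, hk, hS⟩ := mem_closure_iff_nhds.1 h1 U hU
  -- Elements of the semigroup come from words of positive exponent sum, which are nontrivial.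
  have : ∀ k ∈ semigroupGen f g,
      ∃ w : FreeGroup Bool, FreeGroup.lift (fun b => cond b f g) w = k ∧
      0 < Multiplicative.toAdd (FreeGroup.lift (fun _ => Multiplicative.ofAdd (1 : ℤ)) w) := by
    intro k hS
    induction hS using Subsemigroup.closure_induction with
    | mem a ha =>
      rcases ha with rfl | rfl
      · exact ⟨FreeGroup.of true, by simp, by simp⟩
      · exact ⟨FreeGroup.of false, by simp, by simp⟩
    | mul a b ha hb iha ihb =>
      obtain ⟨w, rfl, hw⟩ := iha
      obtain ⟨w', rfl, hw'⟩ := ihb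
      exact ⟨w * w', by simp, by simp; omega⟩
  obtain ⟨w, rfl, hpos⟩ := this k hS
  refine hw w ?_ hk
  rintro rfl
  simp at hpos

/-- Here `φ` rewrites words in `f, g` as words in `f', g'`; the left inverse `ψ` makes it injective,
so nontrivial words stay nontrivial and the same neighbourhood works. -/
theorem FreelyDiscrete.of_hom {f g f' g' : Mob} (h : FreelyDiscrete f' g')
    {φ ψ : FreeGroup Bool →* FreeGroup Bool} (hφψ : ψ.comp φ = MonoidHom.id _)
    (hφ : (FreeGroup.lift (fun b => cond b f' g')).comp φ = FreeGroup.lift (fun b => cond b f g)) :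
    FreelyDiscrete f g := by
  obtain ⟨U, hU, hw⟩ := h
  refine ⟨U, hU, fun w hne => ?_⟩
  rw [← hφ]
  refine hw (φ w) fun h1 => hne ?_
  have := DFunLike.congr_fun hφψ w
  simpa [h1] using this.symm

theorem FreelyDiscrete.of_mul_right {f g : Mob} (h : FreelyDiscrete f (f * g)) :
    FreelyDiscrete f g := by
  refine h.of_hom (φ := FreeGroup.lift fun b => cond b (.of true) ((.of true)⁻¹ * .of false))
    (ψ := FreeGroup.lift fun b => cond b (.of true) (.of true * .of false)) ?_ ?_
  · ext b; cases b <;> simp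
  · ext b; cases b <;> simp

theorem FreelyDiscrete.swap {f g : Mob} (h : FreelyDiscrete f g) : FreelyDiscrete g f := by
  refine h.of_hom (φ := FreeGroup.lift fun b => .of !b) (ψ := FreeGroup.lift fun b => .of !b) ?_ ?_
  · ext b; simp
  · ext b; cases b <;> simp

theorem closure_mul_right (f g : Mob) :
    Subgroup.closure {f, f * g} = Subgroup.closure ({f, g} : Set Mob) := by
  apply le_antisymm <;> rw [Subgroup.closure_le]
  · rintro x (rfl | rfl)
    · exact Subgroup.subset_closure (by simp)
    · exact mul_mem (Subgroup.subset_closure (by simp)) (Subgroup.subset_closure (by simp))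
  · rintro x (rfl | rfl)
    · exact Subgroup.subset_closure (by simp)
    · have : x = f⁻¹ * (f * x) := by group
      rw [this]
      exact mul_mem (inv_mem (Subgroup.subset_closure (by simp)))
        (Subgroup.subset_closure (by simp))

theorem semigroupGen_subset_closure (f g : Mob) :
    (semigroupGen f g : Set Mob) ⊆ (Subgroup.closure {f, g} : Subgroup Mob) := by
  have : semigroupGen f g ≤ (Subgroup.closure {f, g} : Subgroup Mob).toSubmonoid.toSubsemigroup :=
    Subsemigroup.closure_le.2 Subgroup.subset_closure
  exact this

/-- The group generated by `f` and `g` is a Schottky group, freely generated by them. -/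
def IsSchottkyBasis (f g : Mob) : Prop :=
  IsSchottkyRankTwo (Subgroup.closure {f, g}) ∧ FreelyDiscrete f g

theorem IsSchottkyBasis.of_mul_right {f g : Mob} (h : IsSchottkyBasis f (f * g)) :
    IsSchottkyBasis f g :=
  ⟨closure_mul_right f g ▸ h.1, h.2.of_mul_right⟩

theorem IsSchottkyBasis.swap {f g : Mob} (h : IsSchottkyBasis f g) : IsSchottkyBasis g f :=
  ⟨Set.pair_comm f g ▸ h.1, h.2.swap⟩

theorem IsSchottkySystem.isSchottkyBasis {u v : Mob} {A B C D : Set (OnePoint ℝ)}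
    (h : IsSchottkySystem u v A B C D) : IsSchottkyBasis u v :=
  ⟨h.isSchottkyRankTwo, h.freelyDiscrete⟩

/-! A normal form for pairs without common fixed points -/

theorem exists_eigenvalue {x : ℝ} (hx : 2 ≤ x) : ∃ l : ℝ, 1 ≤ l ∧ l + l⁻¹ = x := by
  have h0 : 0 ≤ x ^ 2 - 4 := by nlinarith
  have hs := Real.sq_sqrt h0
  have hs0 := Real.sqrt_nonneg (x ^ 2 - 4)
  refine ⟨(x + √(x ^ 2 - 4)) / 2, by linarith, ?_⟩
  have : x + √(x ^ 2 - 4) ≠ 0 := by positivity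
  field_simp
  linear_combination hs

theorem exists_eigenvector (A : SL(2, ℝ)) {l : ℝ} (hl : l ≠ 0) (h : l + l⁻¹ = A 0 0 + A 1 1) :
    ∃ p r : ℝ, (p ≠ 0 ∨ r ≠ 0) ∧ A 0 0 * p + A 0 1 * r = l * p ∧ A 1 0 * p + A 1 1 * r = l * r := by
  have hd := det_eq_one A
  have hdet : ((A : Matrix (Fin 2) (Fin 2) ℝ) - Matrix.diagonal fun _ => l).det = 0 := by
    rw [Matrix.det_fin_two]
    simp
    have : l * (l + l⁻¹) = l ^ 2 + 1 := by field_simp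
    rw [h] at this
    linear_combination hd - this
  obtain ⟨v, hv, hv'⟩ := Matrix.exists_mulVec_eq_zero_iff.2 hdet
  have h0 := congrFun hv' 0
  have h1 := congrFun hv' 1
  simp at h0 h1
  refine ⟨v 0, v 1, ?_, by linarith, by linarith⟩
  by_contra! hc
  apply hv
  ext i
  fin_cases i
  exacts [hc.1, hc.2]

/-- Cramer's rule: `h` says that the second coordinate of `(u, w)` in the basis `(p, r)`, `(q, s)`
is `b`. -/
theorem exists_coord {p q r s u w b : ℝ} (hD : p * s - q * r ≠ 0)
    (h : p * w - r * u = b * (p * s - q * r)) :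
    ∃ a, u = a * p + b * q ∧ w = a * r + b * s := by
  obtain ⟨a, ha⟩ : ∃ a, a * (p * s - q * r) = u * s - w * q := ⟨_, div_mul_cancel₀ _ hD⟩
  refine ⟨a, mul_left_cancel₀ hD ?_, mul_left_cancel₀ hD ?_⟩
  · linear_combination q * h - p * ha
  · linear_combination s * h - r * ha

theorem smul_pt_of_eigenvector {A : SL(2, ℝ)} {l p r : ℝ} (hl : l ≠ 0) (hpr : p ≠ 0 ∨ r ≠ 0)
    (h0 : A 0 0 * p + A 0 1 * r = l * p) (h1 : A 1 0 * p + A 1 1 * r = l * r) :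
    ofMatrix A • pt p r = pt p r := by
  rw [ofMatrix_smul_pt A hpr, h0, h1, pt_mul hl]

/-- The matrices `F`, `G` are conjugate by `K` to an upper and a lower triangular matrix, with
leading eigenvectors `(1, 0)` and `(0, 1)`. -/
structure IsNormalForm (F G : SL(2, ℝ)) (K : GL (Fin 2) ℝ) (l m k : ℝ) : Prop where
  one_le_left : 1 ≤ l
  one_le_right : 1 ≤ m
  ne_zero : k ≠ 0
  left_eq : (F : Matrix (Fin 2) (Fin 2) ℝ) * K = K * !![l, 1; 0, l⁻¹]
  right_eq : (G : Matrix (Fin 2) (Fin 2) ℝ) * K = K * !![m⁻¹, 0; k, m]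

theorem exists_normalForm (F G : SL(2, ℝ)) (hF : 2 ≤ F 0 0 + F 1 1) (hG : 2 ≤ G 0 0 + G 1 1)
    (hfix : ∀ x : OnePoint ℝ, ¬ (ofMatrix F • x = x ∧ ofMatrix G • x = x)) :
    ∃ K l m k, IsNormalForm F G K l m k := by
  obtain ⟨l, hl1, hl⟩ := exists_eigenvalue hF
  obtain ⟨m, hm1, hm⟩ := exists_eigenvalue hG
  have hl0 : l ≠ 0 := by positivity
  have hm0 : m ≠ 0 := by positivity
  obtain ⟨p, r, hpr, hp, hr⟩ := exists_eigenvector F hl0 hl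
  obtain ⟨q, s, hqs, hq, hs⟩ := exists_eigenvector G hm0 hm
  have hFp := smul_pt_of_eigenvector hl0 hpr hp hr
  have hGq := smul_pt_of_eigenvector hm0 hqs hq hs
  -- Dependent leading eigenvectors would give a common fixed point.
  have hD : p * s - q * r ≠ 0 := by
    intro h
    have : pt p r = pt q s := (pt_eq_pt hpr hqs).2 (by linarith)
    exact hfix _ ⟨hFp, by rw [this, hGq]⟩
  have hdF := det_eq_one F
  have hdG := det_eq_one G
  obtain ⟨a, ha0, ha1⟩ : ∃ a, F 0 0 * q + F 0 1 * s = a * p + l⁻¹ * q ∧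
      F 1 0 * q + F 1 1 * s = a * r + l⁻¹ * s := by
    -- Determinant one forces the other diagonal entry to be `l⁻¹`.
    have hb : p * (F 1 0 * q + F 1 1 * s) - r * (F 0 0 * q + F 0 1 * s) =
        l⁻¹ * (p * s - q * r) := by
      field_simp
      linear_combination (-(F 1 0 * q + F 1 1 * s)) * hp + (F 0 0 * q + F 0 1 * s) * hr +
        (p * s - q * r) * hdF
    exact exists_coord hD hb
  obtain ⟨c, hc0, hc1⟩ : ∃ c, G 0 0 * p + G 0 1 * r = m⁻¹ * p + c * q ∧
      G 1 0 * p + G 1 1 * r = m⁻¹ * r + c * s := by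
    have hb : (G 0 0 * p + G 0 1 * r) * s - (G 1 0 * p + G 1 1 * r) * q =
        m⁻¹ * (p * s - q * r) := by
      field_simp
      linear_combination (-(G 0 0 * p + G 0 1 * r)) * hs + (G 1 0 * p + G 1 1 * r) * hq +
        (p * s - q * r) * hdG
    obtain ⟨c, h0, h1⟩ := exists_coord (p := q) (r := s) (q := p) (s := r) (b := m⁻¹)
      (u := G 0 0 * p + G 0 1 * r) (w := G 1 0 * p + G 1 1 * r)
      (fun h => hD (by linarith))
      (by linear_combination -hb)
    exact ⟨c, by linarith, by linarith⟩
  have ha : a ≠ 0 := by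
    rintro rfl
    exact hfix _ ⟨smul_pt_of_eigenvector (inv_ne_zero hl0) hqs (by linarith) (by linarith), hGq⟩
  have hc : c ≠ 0 := by
    rintro rfl
    exact hfix _ ⟨hFp, smul_pt_of_eigenvector (inv_ne_zero hm0) hpr (by linarith) (by linarith)⟩
  -- Scaling the first basis vector by `a` turns the entry `a` of `F` into `1` and the entry `c` of
  -- `G` into `a * c`.
  refine ⟨Matrix.GeneralLinearGroup.mkOfDetNeZero !![a * p, q; a * r, s] ?_, l, m, a * c, hl1, hm1,
    mul_ne_zero ha hc, ?_, ?_⟩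
  · rw [Matrix.det_fin_two_of]
    have := mul_ne_zero ha hD
    intro h
    apply this
    linarith
  · ext i j
    fin_cases i <;> fin_cases j <;>
      simp [Matrix.mul_apply, Fin.sum_univ_two, Matrix.GeneralLinearGroup.mkOfDetNeZero]
    · linear_combination a * hp
    · linear_combination ha0
    · linear_combination a * hr
    · linear_combination ha1
  · ext i j
    fin_cases i <;> fin_cases j <;>
      simp [Matrix.mul_apply, Fin.sum_univ_two, Matrix.GeneralLinearGroup.mkOfDetNeZero]
    · linear_combination a * hc0
    · linear_combination hq
    · linear_combination a * hc1
    · linear_combination hs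

/-! ### Traces and triangular models of the normal form -/

namespace IsNormalForm

variable {F G : SL(2, ℝ)} {K : GL (Fin 2) ℝ} {l m k : ℝ}

theorem trace_of_mul_eq {A B K : Matrix (Fin 2) (Fin 2) ℝ} (hK : IsUnit K) (h : A * K = K * B) :
    A 0 0 + A 1 1 = B 0 0 + B 1 1 := by
  obtain ⟨K, rfl⟩ := hK
  have : A = K * B * (K⁻¹ : (Matrix (Fin 2) (Fin 2) ℝ)ˣ) := by
    rw [← h, Units.mul_inv_cancel_right]
  rw [← Matrix.trace_fin_two, ← Matrix.trace_fin_two, this, Matrix.trace_mul_cycle, Units.inv_mul,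
    one_mul]

theorem trace_left (h : IsNormalForm F G K l m k) : F 0 0 + F 1 1 = l + l⁻¹ := by
  simpa using trace_of_mul_eq K.isUnit h.left_eq

theorem trace_right (h : IsNormalForm F G K l m k) : G 0 0 + G 1 1 = m + m⁻¹ := by
  rw [add_comm m]
  simpa using trace_of_mul_eq K.isUnit h.right_eq

theorem trace_mul (h : IsNormalForm F G K l m k) :
    (F * G) 0 0 + (F * G) 1 1 = l / m + m / l + k := by
  have : ((F * G : SL(2, ℝ)) : Matrix (Fin 2) (Fin 2) ℝ) * K =
      K * (!![l, 1; 0, l⁻¹] * !![m⁻¹, 0; k, m]) := by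
    rw [Matrix.SpecialLinearGroup.coe_mul, mul_assoc, h.right_eq, ← mul_assoc, h.left_eq, mul_assoc]
  rw [trace_of_mul_eq K.isUnit this]
  simp
  ring

/-- The upper triangular representative of the first matrix. -/
noncomputable def upper (l : ℝ) (hl : l ≠ 0) : SL(2, ℝ) :=
  ⟨!![l, 1; 0, l⁻¹], by simp [hl]⟩

/-- The lower triangular representative of the second matrix. -/
noncomputable def lower (m k : ℝ) (hm : m ≠ 0) : SL(2, ℝ) :=
  ⟨!![m⁻¹, 0; k, m], by simp [hm]⟩

theorem left_ne_zero (h : IsNormalForm F G K l m k) : l ≠ 0 := by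
  have := h.one_le_left
  positivity

theorem right_ne_zero (h : IsNormalForm F G K l m k) : m ≠ 0 := by
  have := h.one_le_right
  positivity

theorem smul_left (h : IsNormalForm F G K l m k) (x : OnePoint ℝ) :
    K • (ofMatrix (upper l h.left_ne_zero) • x) = ofMatrix F • (K • x) := by
  rw [ofMatrix_smul, ofMatrix_smul, ← mul_smul, ← mul_smul]
  congr 1
  ext1
  exact h.left_eq.symm

theorem smul_right (h : IsNormalForm F G K l m k) (x : OnePoint ℝ) :
    K • (ofMatrix (lower m k h.right_ne_zero) • x) = ofMatrix G • (K • x) := by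
  rw [ofMatrix_smul, ofMatrix_smul, ← mul_smul, ← mul_smul]
  congr 1
  ext1
  exact h.right_eq.symm

end IsNormalForm

/-! Arcs avoiding or bounded by `∞` -/

theorem isOpenInterval_coe_image {s : Set ℝ} (h : IsOpen s) (hs : IsConnected s) :
    IsOpenInterval (((↑) : ℝ → OnePoint ℝ) '' s) :=
  ⟨OnePoint.isOpen_image_coe.2 h, hs.image _ OnePoint.continuous_coe.continuousOn, fun he =>
    OnePoint.infty_notMem_image_coe (he ▸ Set.mem_univ ∞)⟩

theorem coe_mem_closure_image {s : Set ℝ} {x : ℝ} :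
    (x : OnePoint ℝ) ∈ closure (((↑) : ℝ → OnePoint ℝ) '' s) ↔ x ∈ closure s := by
  rw [OnePoint.isOpenEmbedding_coe.isInducing.closure_eq_preimage_closure_image s,
    Set.mem_preimage]

theorem coe_mem_image {s : Set ℝ} {x : ℝ} :
    (x : OnePoint ℝ) ∈ ((↑) : ℝ → OnePoint ℝ) '' s ↔ x ∈ s :=
  OnePoint.coe_injective.mem_set_image

theorem infty_mem_closure_Ioi (p : ℝ) :
    ∞ ∈ closure (((↑) : ℝ → OnePoint ℝ) '' Ioi p) := by
  have h : Tendsto ((↑) : ℝ → OnePoint ℝ) atTop (𝓝 ∞) :=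
    OnePoint.tendsto_coe_infty.mono_left (by
      rw [coclosedCompact_eq_cocompact]; exact atTop_le_cocompact)
  exact mem_closure_of_tendsto h ((eventually_gt_atTop p).mono fun x hx => ⟨x, hx, rfl⟩)

theorem infty_mem_closure_Iio (p : ℝ) :
    ∞ ∈ closure (((↑) : ℝ → OnePoint ℝ) '' Iio p) := by
  have h : Tendsto ((↑) : ℝ → OnePoint ℝ) atBot (𝓝 ∞) :=
    OnePoint.tendsto_coe_infty.mono_left (by
      rw [coclosedCompact_eq_cocompact]; exact atBot_le_cocompact)
  exact mem_closure_of_tendsto h ((eventually_lt_atBot p).mono fun x hx => ⟨x, hx, rfl⟩)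

theorem infty_notMem_closure_Ioo (p q : ℝ) :
    ∞ ∉ closure (((↑) : ℝ → OnePoint ℝ) '' Ioo p q) := by
  intro h
  have h1 : IsClosed (((↑) : ℝ → OnePoint ℝ) '' Icc p q) :=
    (isCompact_Icc.image OnePoint.continuous_coe).isClosed
  exact OnePoint.infty_notMem_image_coe
    (closure_minimal (Set.image_mono Ioo_subset_Icc_self) h1 h)

theorem image_smul_eq {f : Mob} {X Y : Set (OnePoint ℝ)} (h : ∀ x, f • x ∈ Y ↔ x ∈ X) :
    (fun x => f • x) '' X = Y := by
  ext y
  constructor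
  · rintro ⟨x, hx, rfl⟩
    exact (h x).2 hx
  · intro hy
    exact ⟨f⁻¹ • y, (h _).1 (by simpa using hy), by simp⟩

/-- The closed arc from `0` to `∞` through the positive reals. -/
def positiveArc : Set (OnePoint ℝ) := insert ∞ (((↑) : ℝ → OnePoint ℝ) '' Ici 0)

theorem coe_mem_positiveArc {x : ℝ} : (x : OnePoint ℝ) ∈ positiveArc ↔ 0 ≤ x := by
  simp [positiveArc]

theorem infty_mem_positiveArc : ∞ ∈ positiveArc := Set.mem_insert _ _

theorem isClosedInterval_positiveArc : IsClosedInterval positiveArc := by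
  have hcompl : positiveArcᶜ = ((↑) : ℝ → OnePoint ℝ) '' Iio 0 := by
    ext x
    induction x using OnePoint.rec with
    | infty => simp [infty_mem_positiveArc]
    | coe x => rw [Set.mem_compl_iff, coe_mem_positiveArc, coe_mem_image, not_le, mem_Iio]
  refine ⟨?_, ?_, ?_, ?_⟩
  · rw [← isOpen_compl_iff, hcompl, OnePoint.isOpen_image_coe]
    exact isOpen_Iio
  · refine IsConnected.subset_closure (s := ((↑) : ℝ → OnePoint ℝ) '' Ioi 0)
      (isConnected_Ioi.image _ OnePoint.continuous_coe.continuousOn) ?_ ?_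
    · exact (Set.image_mono Ioi_subset_Ici_self).trans (Set.subset_insert _ _)
    · intro x hx
      induction x using OnePoint.rec with
      | infty => exact infty_mem_closure_Ioi 0
      | coe x =>
        rw [coe_mem_closure_image, closure_Ioi]
        exact coe_mem_positiveArc.1 hx
  · exact ⟨∞, infty_mem_positiveArc, ((0 : ℝ) : OnePoint ℝ), coe_mem_positiveArc.2 le_rfl,
      OnePoint.infty_ne_coe _⟩
  · intro h
    have : ((-1 : ℝ) : OnePoint ℝ) ∈ positiveArc := h ▸ Set.mem_univ _
    rw [coe_mem_positiveArc] at this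
    norm_num at this

theorem IsClosedInterval.image {J : Set (OnePoint ℝ)} (hJ : IsClosedInterval J)
    (φ : OnePoint ℝ ≃ₜ OnePoint ℝ) : IsClosedInterval (φ '' J) :=
  ⟨φ.isClosedMap _ hJ.1, hJ.2.1.image _ φ.continuous.continuousOn, hJ.2.2.1.image φ.injective,
    fun h => hJ.2.2.2 (by
      rwa [← Set.image_univ_of_surjective φ.surjective, φ.injective.image_injective.eq_iff] at h)⟩

theorem MapsStrictlyInside.conj {f f' : Mob} {J : Set (OnePoint ℝ)} (h : MapsStrictlyInside f J)
    (φ : OnePoint ℝ ≃ₜ OnePoint ℝ) (hf : ∀ x, φ (f • x) = f' • φ x) :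
    MapsStrictlyInside f' (φ '' J) := by
  have : (fun x => f' • x) '' (φ '' J) = φ '' ((fun x => f • x) '' J) := by
    rw [Set.image_image, Set.image_image]
    simp only [hf]
  rw [MapsStrictlyInside, this]
  exact ⟨Set.image_mono h.1, fun h' => h.2 ((Set.image_subset_image_iff φ.injective).1 h')⟩

theorem mapsStrictlyInside_iff {f : Mob} {J : Set (OnePoint ℝ)} :
    MapsStrictlyInside f J ↔ (∀ x ∈ J, f • x ∈ J) ∧ ∃ y ∈ J, ∀ x ∈ J, f • x ≠ y := by
  rw [MapsStrictlyInside, Set.ssubset_iff_exists, Set.image_subset_iff]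
  simp only [Set.mem_image, not_exists, not_and, Set.subset_def, Set.mem_preimage, ne_eq]

/-! ### The invariant arc for `k > 0` and the Schottky intervals for `k < 0` -/

namespace IsNormalForm

theorem upper_smul_coe (l : ℝ) (hl : l ≠ 0) (x : ℝ) :
    ofMatrix (upper l hl) • (x : OnePoint ℝ) = ((l ^ 2 * x + l : ℝ) : OnePoint ℝ) := by
  rw [ofMatrix_smul_coe]
  simp [upper, hl]
  ring

theorem upper_smul_infty (l : ℝ) (hl : l ≠ 0) : ofMatrix (upper l hl) • (∞ : OnePoint ℝ) = ∞ := by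
  rw [ofMatrix_smul_infty]
  simp [upper]

theorem lower_smul_coe (m k : ℝ) (hm : m ≠ 0) (x : ℝ) :
    ofMatrix (lower m k hm) • (x : OnePoint ℝ) =
      if k * x + m = 0 then ∞ else ((m⁻¹ * x / (k * x + m) : ℝ) : OnePoint ℝ) := by
  rw [ofMatrix_smul_coe]
  simp [lower]

theorem lower_smul_infty (m k : ℝ) (hm : m ≠ 0) (hk : k ≠ 0) :
    ofMatrix (lower m k hm) • (∞ : OnePoint ℝ) = ((m⁻¹ / k : ℝ) : OnePoint ℝ) := by
  rw [ofMatrix_smul_infty]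
  simp [lower, hk]

variable {F G : SL(2, ℝ)} {K : GL (Fin 2) ℝ} {l m k : ℝ}

/-- The arc `[0, ∞]` goes to `[l, ∞]`, which misses `0`, under the upper triangular map, and to `[0,
m⁻¹ / k]`, which misses `∞`, under the lower one. -/
theorem exists_closedInterval (h : IsNormalForm F G K l m k) (hk : 0 < k) :
    ∃ J, IsClosedInterval J ∧ MapsStrictlyInside (ofMatrix F) J ∧
      MapsStrictlyInside (ofMatrix G) J := by
  have hl : 0 < l := by linarith [h.one_le_left]
  have hm : 0 < m := by linarith [h.one_le_right]
  refine ⟨glHomeo K '' positiveArc, isClosedInterval_positiveArc.image _,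
    MapsStrictlyInside.conj ?_ (glHomeo K) h.smul_left,
    MapsStrictlyInside.conj ?_ (glHomeo K) h.smul_right⟩
  · rw [mapsStrictlyInside_iff]
    refine ⟨fun x hx => ?_, ((0 : ℝ) : OnePoint ℝ), coe_mem_positiveArc.2 le_rfl, fun x hx => ?_⟩
    all_goals induction x using OnePoint.rec with
    | infty =>
      rw [upper_smul_infty]
      first | exact infty_mem_positiveArc | exact OnePoint.infty_ne_coe _
    | coe x =>
      rw [coe_mem_positiveArc] at hx
      rw [upper_smul_coe]
      first
      | rw [coe_mem_positiveArc]; positivity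
      | rw [ne_eq, OnePoint.coe_eq_coe]; positivity
  · rw [mapsStrictlyInside_iff]
    refine ⟨fun x hx => ?_, ∞, infty_mem_positiveArc, fun x hx => ?_⟩
    all_goals induction x using OnePoint.rec with
    | infty =>
      rw [lower_smul_infty _ _ _ h.ne_zero]
      first
      | rw [coe_mem_positiveArc]; positivity
      | exact OnePoint.coe_ne_infty _
    | coe x =>
      rw [coe_mem_positiveArc] at hx
      rw [lower_smul_coe, if_neg (by positivity)]
      first
      | rw [coe_mem_positiveArc]; positivity
      | exact OnePoint.coe_ne_infty _

/-- Multiplying by positive factors, squares of denominators among them, reduces comparisons of the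
image of `t` with `0` and with the image of `q` to signs of polynomials. -/
theorem lower_value_sign {m k t q : ℝ} (hm : 0 < m) (hn : k * t + m ≠ 0) (hq : k * q + m < 0) :
    ((0 ≤ m⁻¹ * t / (k * t + m) ↔ 0 ≤ t * (k * t + m)) ∧
      (0 < m⁻¹ * t / (k * t + m) ↔ 0 < t * (k * t + m))) ∧
    (m⁻¹ * t / (k * t + m) ≤ m⁻¹ * q / (k * q + m) ↔ 0 ≤ (t - q) * (k * t + m)) ∧
      (m⁻¹ * t / (k * t + m) < m⁻¹ * q / (k * q + m) ↔ 0 < (t - q) * (k * t + m)) := by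
  have h1 : m⁻¹ * t / (k * t + m) = t * (k * t + m) * (m⁻¹ * ((k * t + m) ^ 2)⁻¹) := by
    field_simp
  have h2 : m⁻¹ * q / (k * q + m) - m⁻¹ * t / (k * t + m) =
      (t - q) * (k * t + m) * ((-(k * q + m))⁻¹ * ((k * t + m) ^ 2)⁻¹) := by
    have hN := hq.ne
    rw [div_sub_div _ _ hN hn, inv_neg]
    field_simp
    ring
  have hn2 : 0 < ((k * t + m) ^ 2)⁻¹ := by positivity
  have hp1 : 0 < m⁻¹ * ((k * t + m) ^ 2)⁻¹ := by positivity
  have hp2 : 0 < (-(k * q + m))⁻¹ * ((k * t + m) ^ 2)⁻¹ :=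
    mul_pos (inv_pos.2 (neg_pos.2 hq)) hn2
  rw [← sub_nonneg (b := m⁻¹ * t / (k * t + m)), ← sub_pos (b := m⁻¹ * t / (k * t + m)), h2, h1,
    mul_nonneg_iff_of_pos_right hp1, mul_pos_iff_of_pos_right hp1, mul_nonneg_iff_of_pos_right hp2,
    mul_pos_iff_of_pos_right hp2]
  simp

/-- The pole `-m / k` lies in `(0, q)`, and on each side of it a single alternative carries the
condition. -/
theorem le_or_le_iff {m k t q : ℝ} (hk : k < 0) (hm : 0 < m) (hn : k * t + m ≠ 0)
    (hq : k * q + m < 0) :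
    (0 ≤ t * (k * t + m) ∨ 0 ≤ (t - q) * (k * t + m) ↔ 0 ≤ t ∧ t ≤ q) ∧
      (0 < t * (k * t + m) ∨ 0 < (t - q) * (k * t + m) ↔ 0 < t ∧ t < q) := by
  rcases lt_or_gt_of_ne hn with h | h
  · have ht : 0 < t := by nlinarith
    have e : ∀ x, (0 ≤ x * (k * t + m) ↔ x ≤ 0) ∧ (0 < x * (k * t + m) ↔ x < 0) := fun x =>
      ⟨⟨fun h' => by nlinarith, fun h' => by nlinarith⟩,
        ⟨fun h' => by nlinarith, fun h' => by nlinarith⟩⟩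
    rw [(e t).1, (e t).2, (e _).1, (e _).2]
    constructor <;> constructor <;> grind
  · have ht : t < q := by nlinarith
    rw [mul_nonneg_iff_of_pos_right h, mul_nonneg_iff_of_pos_right h, mul_pos_iff_of_pos_right h,
      mul_pos_iff_of_pos_right h]
    constructor <;> constructor <;> grind

/-- The lower map fixes `0`, sends `q` to `p` and has its pole in `(0, q)`, so it exchanges the
inside of `(0, q)` with the outside of `[p, 0]`. The upper map is increasing and affine. Hence
`hpq`, which separates `B` from `C`, is the only compatibility condition. -/
theorem isSchottkySystem_triangular (hl : 0 < l) (hm : 0 < m) (hk : k < 0) {p q : ℝ}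
    (hq : k * q + m < 0) (hp : p = m⁻¹ * q / (k * q + m)) (hpq : q ≤ l ^ 2 * p + l) :
    IsSchottkySystem (ofMatrix (upper l hl.ne')) (ofMatrix (lower m k hm.ne'))
      (((↑) : ℝ → OnePoint ℝ) '' Iio p) (((↑) : ℝ → OnePoint ℝ) '' Ioi (l ^ 2 * p + l))
      (((↑) : ℝ → OnePoint ℝ) '' Ioo 0 q) (((↑) : ℝ → OnePoint ℝ) '' Ioo p 0) := by
  have hq0 : 0 < q := by nlinarith
  have hp0 : p < 0 := by
    rw [hp]
    exact div_neg_of_pos_of_neg (by positivity) hq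
  have hl2 : 0 < l ^ 2 := by positivity
  have hinf : p < m⁻¹ / k ∧ m⁻¹ / k < 0 := by
    refine ⟨?_, div_neg_of_pos_of_neg (by positivity) hk⟩
    have e : m⁻¹ / k - p = 1 / (k * (k * q + m)) := by
      have h1 := hq.ne
      have h2 := hk.ne
      rw [hp, div_sub_div _ _ h2 h1]
      field_simp
      ring
    have : 0 < 1 / (k * (k * q + m)) := one_div_pos.2 (mul_pos_of_neg_of_neg hk hq)
    linarith
  refine ⟨isOpenInterval_coe_image isOpen_Iio isConnected_Iio,
    isOpenInterval_coe_image isOpen_Ioi isConnected_Ioi,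
    isOpenInterval_coe_image isOpen_Ioo (isConnected_Ioo hq0),
    isOpenInterval_coe_image isOpen_Ioo (isConnected_Ioo hp0), ?_, ?_, ?_, ?_, ?_⟩
  · have hdisj : ∀ {s t : Set ℝ}, (∀ x ∈ s, x ∉ t) →
        Disjoint (((↑) : ℝ → OnePoint ℝ) '' s) (((↑) : ℝ → OnePoint ℝ) '' t) := fun h =>
      (Set.disjoint_image_iff OnePoint.coe_injective).2 (Set.disjoint_left.2 h)
    simp only [List.pairwise_cons, List.mem_cons, List.not_mem_nil, or_false, forall_eq_or_imp,
      forall_eq, IsEmpty.forall_iff, implies_true, List.Pairwise.nil, and_true]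
    have hpB : p < l ^ 2 * p + l := by linarith
    refine ⟨⟨hdisj ?_, hdisj ?_, hdisj ?_⟩, ⟨hdisj ?_, hdisj ?_⟩, hdisj ?_⟩ <;>
      simp only [mem_Iio, mem_Ioi, mem_Ioo] <;> intro x hx hx' <;> linarith
  all_goals
    refine image_smul_eq fun x => ?_
    simp only [Set.mem_compl_iff]
    induction x using OnePoint.rec with
    | infty =>
      simp only [upper_smul_infty, lower_smul_infty _ _ _ hk.ne, coe_mem_image,
        coe_mem_closure_image, infty_mem_closure_Ioi, infty_mem_closure_Iio,
        infty_notMem_closure_Ioo, OnePoint.infty_notMem_image_coe, closure_Ioo hp0.ne, mem_Icc,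
        mem_Ioo, not_true_eq_false, not_false_eq_true, hinf, hinf.1.le, hinf.2.le, and_self]
    | coe t => ?_
  · simp [upper_smul_coe, coe_mem_closure_image, hl2]
  · simp [upper_smul_coe, coe_mem_closure_image, hl2]
  · rw [lower_smul_coe, coe_mem_closure_image, closure_Ioo hq0.ne, mem_Icc]
    split_ifs with ht
    · simp only [OnePoint.infty_notMem_image_coe, false_iff, not_not]
      constructor <;> nlinarith
    · obtain ⟨⟨h1, -⟩, h2, -⟩ := lower_value_sign hm ht hq
      rw [coe_mem_image, mem_Ioo, hp, ← (le_or_le_iff hk hm ht hq).1, ← h1, ← h2, not_or, not_le,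
        not_le, and_comm]
  · rw [lower_smul_coe, coe_mem_image, mem_Ioo]
    split_ifs with ht
    · simp only [infty_notMem_closure_Ioo, not_false_eq_true, true_iff]
      constructor <;> nlinarith
    · obtain ⟨⟨-, h1⟩, -, h2⟩ := lower_value_sign hm ht hq
      rw [coe_mem_closure_image, closure_Ioo hp0.ne, mem_Icc, hp, ← (le_or_le_iff hk hm ht hq).2,
        ← h1, ← h2, not_and_or, not_le, not_le, or_comm]

theorem isSchottkyBasis (h : IsNormalForm F G K l m k) (hk : k < 0)
    (hz : (F * G) 0 0 + (F * G) 1 1 ≤ -2) : IsSchottkyBasis (ofMatrix F) (ofMatrix G) := by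
  have hl : 0 < l := by linarith [h.one_le_left]
  have hm : 0 < m := by linarith [h.one_le_right]
  set z := (F * G) 0 0 + (F * G) 1 1 with hzd
  have hzk : k = z - l / m - m / l := by rw [hzd, h.trace_mul]; ring
  clear_value z
  -- In terms of `N = k * q + m < 0`, the condition `hpq` reads `N ^ 2 - l * z * N + l ^ 2 ≤ 0`. The
  -- vertex `N = l * z / 2` is chosen; there the condition holds because `z ≤ -2`.
  set q := (l * z - 2 * m) / (2 * k) with hqd
  have hkq : k * q + m = l * z / 2 := by
    have hk0 := hk.ne
    rw [hqd]
    field_simp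
    ring
  have hq : k * q + m < 0 := by
    rw [hkq]
    nlinarith
  have hpq : q ≤ l ^ 2 * (m⁻¹ * q / (k * q + m)) + l := by
    have e : l ^ 2 * (m⁻¹ * q / (k * q + m)) + l - q = l * (z ^ 2 - 4) / (2 * (k * z)) := by
      have hz0 : z ≠ 0 := by linarith
      have hk0 := hk.ne
      rw [hkq, hqd]
      field_simp
      rw [hzk]
      field_simp
      ring
    have : 0 ≤ l * (z ^ 2 - 4) / (2 * (k * z)) :=
      div_nonneg (mul_nonneg hl.le (by nlinarith)) (by nlinarith)
    linarith
  exact ((isSchottkySystem_triangular hl hm hk hq rfl hpq).conj (glHomeo K) h.smul_left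
    h.smul_right).isSchottkyBasis

end IsNormalForm

/-! Trace identities -/

theorem trace_coe_mul (F G : SL(2, ℝ)) : (F * G) 0 0 + (F * G) 1 1 =
    F 0 0 * G 0 0 + F 0 1 * G 1 0 + (F 1 0 * G 0 1 + F 1 1 * G 1 1) := by
  rw [Matrix.SpecialLinearGroup.coe_mul]
  simp [Matrix.mul_apply, Fin.sum_univ_two]

theorem trace_mul_comm (F G : SL(2, ℝ)) :
    (G * F) 0 0 + (G * F) 1 1 = (F * G) 0 0 + (F * G) 1 1 := by
  rw [trace_coe_mul, trace_coe_mul]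
  ring

/-- Cayley–Hamilton: `F ^ 2` is the trace of `F` times `F`, minus the identity. -/
theorem trace_mul_mul (F G : SL(2, ℝ)) : (F * (F * G)) 0 0 + (F * (F * G)) 1 1 =
    (F 0 0 + F 1 1) * ((F * G) 0 0 + (F * G) 1 1) - (G 0 0 + G 1 1) := by
  rw [trace_coe_mul, trace_coe_mul]
  simp only [Matrix.SpecialLinearGroup.coe_mul, Matrix.mul_apply, Fin.sum_univ_two]
  linear_combination (-(G 0 0 + G 1 1)) * det_eq_one F

/-- The trace of the commutator of two matrices with traces `x`, `y` and product of trace `z`,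
decreased by `2`. -/
def commutatorTrace (x y z : ℝ) : ℝ := x ^ 2 + y ^ 2 + z ^ 2 - x * y * z - 4

/-- The Fricke trace identity. -/
theorem tr_commutator (F G : SL(2, ℝ)) :
    tr (ofMatrix F * ofMatrix G * (ofMatrix F)⁻¹ * (ofMatrix G)⁻¹) =
      |commutatorTrace (F 0 0 + F 1 1) (G 0 0 + G 1 1) ((F * G) 0 0 + (F * G) 1 1) + 2| := by
  have : ofMatrix F * ofMatrix G * (ofMatrix F)⁻¹ * (ofMatrix G)⁻¹ =
      ofMatrix (F * G * F⁻¹ * G⁻¹) := rfl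
  rw [this, tr_ofMatrix', trace_coe_mul]
  congr 1
  simp only [Matrix.SpecialLinearGroup.coe_mul, Matrix.mul_apply, Fin.sum_univ_two,
    Matrix.SpecialLinearGroup.coe_inv, Matrix.adjugate_fin_two, Matrix.of_apply,
    Matrix.cons_val_zero, Matrix.cons_val_one, Matrix.cons_val', Matrix.cons_val_fin_one,
    commutatorTrace]
  linear_combination ((G 0 0 + G 1 1) ^ 2 - 2 * (G 0 0 * G 1 1 - G 0 1 * G 1 0)) * det_eq_one F +
    ((F 0 0 + F 1 1) ^ 2 - 2) * det_eq_one G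

/-- The condition on the traces `x`, `y`, `z` of two matrices and of their product that expresses
that the axes are disjoint and oppositely oriented. -/
def Antiparallel (x y z : ℝ) : Prop := 2 * z < x * y ∧ 0 < commutatorTrace x y z

theorem Antiparallel.comm {x y z : ℝ} (h : Antiparallel x y z) : Antiparallel y x z := by
  unfold Antiparallel commutatorTrace at *
  constructor <;> linarith [h.1, h.2]

/-- A Vieta involution: as a quadratic in `y`, the polynomial is invariant under `y ↦ x * z - y`. It
is the invariant of the descent. -/
theorem commutatorTrace_mul (x y z : ℝ) :
    commutatorTrace x z (x * z - y) = commutatorTrace x y z := by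
  unfold commutatorTrace
  ring

theorem commutatorTrace_comm (x y z : ℝ) : commutatorTrace x y z = commutatorTrace y x z := by
  unfold commutatorTrace
  ring

/-- The two sides of the bound differ by `(x - 2) * (y ^ 2 - x - 2) ≥ 0`. As the commutator term is
positive, `z < y`, and the bound measures the gap `y - z` from below. -/
theorem Antiparallel.lt {x y z : ℝ} (h : Antiparallel x y z) (hx : 2 ≤ x) (hxy : x ≤ y) :
    z < y ∧ commutatorTrace x y z ≤ (y - z) * (x * y - y - z) := by
  obtain ⟨h1, h2⟩ := h
  have h3 : commutatorTrace x y z ≤ (y - z) * (x * y - y - z) := by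
    have : (y - z) * (x * y - y - z) - commutatorTrace x y z = (x - 2) * (y ^ 2 - x - 2) := by
      unfold commutatorTrace
      ring
    have : 0 ≤ (x - 2) * (y ^ 2 - x - 2) := mul_nonneg (by linarith) (by nlinarith)
    linarith
  refine ⟨?_, h3⟩
  by_contra! hz
  have : (y - z) * (x * y - y - z) ≤ 0 :=
    mul_nonpos_of_nonpos_of_nonneg (by linarith) (by linarith)
  linarith

theorem Antiparallel.mul {x y z : ℝ} (h : Antiparallel x y z) (hx : 2 ≤ x) (hxy : x ≤ y)
    (hz : 2 ≤ z) : Antiparallel x z (x * z - y) := by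
  refine ⟨?_, by rw [commutatorTrace_mul]; exact h.2⟩
  obtain ⟨hzy, -⟩ := h.lt hx hxy
  have h2 := h.2
  by_contra! hc
  unfold commutatorTrace at h2
  -- If `2 * y ≤ x * z`, then in either case `h3` and `h4` add up to minus the commutator term,
  -- contradicting its positivity.
  rcases le_total z x with hzx | hzx
  · have h3 : 0 ≤ (y - x) * (x * z - y - x) := mul_nonneg (by linarith) (by linarith)
    have h4 : 0 ≤ (z - 2) * (x ^ 2 - z - 2) := mul_nonneg (by linarith) (by nlinarith)
    nlinarith
  · have h3 : 0 ≤ (y - z) * (x * z - y - z) := mul_nonneg (by linarith) (by linarith)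
    have h4 : 0 ≤ (x - 2) * (z ^ 2 - x - 2) := mul_nonneg (by linarith) (by nlinarith)
    nlinarith

/-- With `s = (l - l⁻¹) * (m - m⁻¹) ≥ 0`, the two antiparallel conditions read `2 * k < s` and `k *
(k - s) > 0`. This expresses the sign of `k` by traces, which can be followed from one pair to the
next. -/
theorem IsNormalForm.neg_iff {F G : SL(2, ℝ)} {K : GL (Fin 2) ℝ} {l m k : ℝ}
    (h : IsNormalForm F G K l m k) :
    k < 0 ↔ Antiparallel (F 0 0 + F 1 1) (G 0 0 + G 1 1) ((F * G) 0 0 + (F * G) 1 1) := by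
  have hl := h.one_le_left
  have hm := h.one_le_right
  have hl0 := h.left_ne_zero
  have hm0 := h.right_ne_zero
  set s := (l - l⁻¹) * (m - m⁻¹) with hs
  have hs0 : 0 ≤ s :=
    mul_nonneg (sub_nonneg.2 ((inv_le_one_of_one_le₀ hl).trans hl))
      (sub_nonneg.2 ((inv_le_one_of_one_le₀ hm).trans hm))
  have e1 : (l + l⁻¹) * (m + m⁻¹) - 2 * (l / m + m / l + k) = s - 2 * k := by
    rw [hs]
    field_simp
    ring
  have e2 : commutatorTrace (l + l⁻¹) (m + m⁻¹) (l / m + m / l + k) = k * (k - s) := by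
    rw [hs, commutatorTrace]
    field_simp
    ring
  rw [h.trace_left, h.trace_right, h.trace_mul, Antiparallel, e2]
  constructor
  · intro hk
    exact ⟨by linarith, mul_pos_of_neg_of_neg hk (by linarith)⟩
  · rintro ⟨h1, h2⟩
    by_contra! hk
    nlinarith

/-! Descent -/

theorem isSchottkyBasis_of_step {δ M : ℝ} {F G : SL(2, ℝ)}
    (hx : 2 ≤ F 0 0 + F 1 1) (hxy : F 0 0 + F 1 1 ≤ G 0 0 + G 1 1) (hM : G 0 0 + G 1 1 ≤ M)
    (hA : Antiparallel (F 0 0 + F 1 1) (G 0 0 + G 1 1) ((F * G) 0 0 + (F * G) 1 1))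
    (hδ' : commutatorTrace (F 0 0 + F 1 1) (G 0 0 + G 1 1) ((F * G) 0 0 + (F * G) 1 1) = δ)
    (hfix : ∀ x : OnePoint ℝ, ¬ (ofMatrix F • x = x ∧ ofMatrix G • x = x))
    (hell : ¬ IsElliptic (ofMatrix F * ofMatrix G))
    (hstep : 2 ≤ (F * G) 0 0 + (F * G) 1 1 →
      (F * G) 0 0 + (F * G) 1 1 + δ / M ^ 2 ≤ G 0 0 + G 1 1 →
      IsSchottkyBasis (ofMatrix F) (ofMatrix (F * G))) :
    IsSchottkyBasis (ofMatrix F) (ofMatrix G) := by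
  obtain ⟨K, l, m, k, hK⟩ := exists_normalForm F G hx (hx.trans hxy) hfix
  have hz : 2 ≤ |(F * G) 0 0 + (F * G) 1 1| := by
    rw [isElliptic_iff, not_lt] at hell
    exact (tr_ofMatrix' (F * G)) ▸ hell
  rcases le_abs.1 hz with hz | hz
  · refine IsSchottkyBasis.of_mul_right (hstep hz ?_)
    obtain ⟨hzy, h⟩ := hA.lt hx hxy
    rw [hδ'] at h
    generalize F 0 0 + F 1 1 = x at *
    generalize G 0 0 + G 1 1 = y at *
    generalize (F * G) 0 0 + (F * G) 1 1 = z at *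
    have hM0 : 0 < M := by linarith
    have h1 : x * y - y - z ≤ M ^ 2 := by nlinarith
    have h2 : δ ≤ (y - z) * M ^ 2 :=
      h.trans (mul_le_mul_of_nonneg_left h1 (by linarith))
    have := (div_le_iff₀ (by positivity : (0 : ℝ) < M ^ 2)).2 h2
    linarith
  · exact hK.isSchottkyBasis (hK.neg_iff.2 hA) (by linarith)

/-- A condition on a pair that passes from `f`, `g` to `f`, `f * g` and excludes that a product of
the pair is elliptic. -/
def NoEllipticDescent (f g : Mob) : Prop :=
  (1 : Mob) ∉ closure (semigroupGen f g : Set Mob) ∨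
    tr f = 2 ∧ ∀ n : ℕ, 0 < n → ¬ IsElliptic (f ^ n * g)

theorem NoEllipticDescent.not_isElliptic {f g : Mob} (h : NoEllipticDescent f g) :
    ¬ IsElliptic (f * g) := by
  rcases h with h | ⟨-, h⟩
  · exact fun he => h (one_mem_closure_of_isElliptic
      (mul_mem (left_mem_semigroupGen f g) (right_mem_semigroupGen f g)) he)
  · simpa using h 1 one_pos

theorem NoEllipticDescent.mul {f g : Mob} (h : NoEllipticDescent f g) :
    NoEllipticDescent f (f * g) := by
  refine h.imp (fun h h' => h (closure_mono (semigroupGen_mul_le _ _) h')) fun h =>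
    ⟨h.1, fun n hn => ?_⟩
  rw [← mul_assoc, ← pow_succ]
  exact h.2 _ n.succ_pos

theorem not_fixed_mul {F G : SL(2, ℝ)}
    (hfix : ∀ x : OnePoint ℝ, ¬ (ofMatrix F • x = x ∧ ofMatrix G • x = x)) (x : OnePoint ℝ) :
    ¬ (ofMatrix F • x = x ∧ ofMatrix (F * G) • x = x) := by
  rintro ⟨h1, h2⟩
  refine hfix x ⟨h1, ?_⟩
  have h3 : ofMatrix (F * G) • x = ofMatrix F • ofMatrix G • x :=
    mul_smul (ofMatrix F) (ofMatrix G) x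
  rw [h3] at h2
  exact MulAction.injective (ofMatrix F) (h2.trans h1.symm)

/-- Each step keeps both traces in `[2, M]` and lowers their sum by at least `δ / M ^ 2`, so `n`
bounds the steps left. The pair is swapped when the order of the traces changes. -/
theorem isSchottkyBasis_of_descent {δ M : ℝ} (hδ : 0 < δ) (n : ℕ) : ∀ F G : SL(2, ℝ),
    2 ≤ F 0 0 + F 1 1 → F 0 0 + F 1 1 ≤ G 0 0 + G 1 1 → G 0 0 + G 1 1 ≤ M →
    F 0 0 + F 1 1 + (G 0 0 + G 1 1) ≤ 4 + n * (δ / M ^ 2) →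
    Antiparallel (F 0 0 + F 1 1) (G 0 0 + G 1 1) ((F * G) 0 0 + (F * G) 1 1) →
    commutatorTrace (F 0 0 + F 1 1) (G 0 0 + G 1 1) ((F * G) 0 0 + (F * G) 1 1) = δ →
    (∀ x : OnePoint ℝ, ¬ (ofMatrix F • x = x ∧ ofMatrix G • x = x)) →
    NoEllipticDescent (ofMatrix F) (ofMatrix G) →
    IsSchottkyBasis (ofMatrix F) (ofMatrix G) := by
  induction n with
  | zero =>
    intro F G hx hxy hM hn hA hδ' hfix hR
    refine isSchottkyBasis_of_step hx hxy hM hA hδ' hfix hR.not_isElliptic fun hz hlt => ?_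
    rw [Nat.cast_zero, zero_mul] at hn
    -- Here both traces equal `2`, so a further decrease to some `z ≥ 2` is impossible.
    have : 0 < δ / M ^ 2 := div_pos hδ (pow_pos (by linarith) 2)
    linarith
  | succ n ih =>
    intro F G hx hxy hM hn hA hδ' hfix hR
    refine isSchottkyBasis_of_step hx hxy hM hA hδ' hfix hR.not_isElliptic fun hz hlt => ?_
    have hδM : 0 < δ / M ^ 2 := div_pos hδ (pow_pos (by linarith) 2)
    push_cast at hn
    have hA' := hA.mul hx hxy hz
    have hfix' := not_fixed_mul hfix
    have hR' : NoEllipticDescent (ofMatrix F) (ofMatrix (F * G)) := hR.mul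
    rcases le_or_gt (F 0 0 + F 1 1) ((F * G) 0 0 + (F * G) 1 1) with hxz | hxz
    · refine ih F (F * G) hx hxz (by linarith) (by linarith) ?_ ?_ hfix' hR'
      · rwa [trace_mul_mul]
      · rwa [trace_mul_mul, commutatorTrace_mul]
    · refine (ih (F * G) F hz hxz.le (by linarith) (by linarith) ?_ ?_
        (fun x hx => hfix' x hx.symm) (.inl ?_)).swap
      · rw [trace_mul_comm F (F * G), trace_mul_mul]
        exact hA'.comm
      · rwa [trace_mul_comm F (F * G), trace_mul_mul, commutatorTrace_comm, commutatorTrace_mul]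
      · rw [semigroupGen_comm]
        -- A swap needs `x > z ≥ 2`, so a parabolic `f` is never swapped and its descent meets only
        -- products `f ^ n * g`.
        refine hR'.resolve_right fun h => ?_
        have := h.1
        rw [tr_ofMatrix', abs_of_nonneg (by linarith)] at this
        linarith

theorem NoEllipticDescent.isSchottkyBasis {F G : SL(2, ℝ)} (hx : 2 ≤ F 0 0 + F 1 1)
    (hxy : F 0 0 + F 1 1 ≤ G 0 0 + G 1 1)
    (hA : Antiparallel (F 0 0 + F 1 1) (G 0 0 + G 1 1) ((F * G) 0 0 + (F * G) 1 1))
    (hfix : ∀ x : OnePoint ℝ, ¬ (ofMatrix F • x = x ∧ ofMatrix G • x = x))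
    (h : NoEllipticDescent (ofMatrix F) (ofMatrix G)) :
    IsSchottkyBasis (ofMatrix F) (ofMatrix G) := by
  set ε := commutatorTrace (F 0 0 + F 1 1) (G 0 0 + G 1 1) ((F * G) 0 0 + (F * G) 1 1) /
    (G 0 0 + G 1 1) ^ 2 with hε
  have hε0 : 0 < ε := div_pos hA.2 (pow_pos (by linarith) 2)
  obtain ⟨n, hn⟩ := Archimedean.arch (F 0 0 + F 1 1 + (G 0 0 + G 1 1)) hε0
  rw [nsmul_eq_mul] at hn
  exact isSchottkyBasis_of_descent hA.2 n F G hx hxy le_rfl (by linarith) hA rfl hfix h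

theorem isSchottkyBasis_of_one_notMem_closure {F G : SL(2, ℝ)} (hx : 2 ≤ F 0 0 + F 1 1)
    (hy : 2 ≤ G 0 0 + G 1 1)
    (hA : Antiparallel (F 0 0 + F 1 1) (G 0 0 + G 1 1) ((F * G) 0 0 + (F * G) 1 1))
    (hfix : ∀ x : OnePoint ℝ, ¬ (ofMatrix F • x = x ∧ ofMatrix G • x = x))
    (h : (1 : Mob) ∉ closure (semigroupGen (ofMatrix F) (ofMatrix G) : Set Mob)) :
    IsSchottkyBasis (ofMatrix F) (ofMatrix G) := by
  rcases le_total (F 0 0 + F 1 1) (G 0 0 + G 1 1) with hxy | hxy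
  · exact NoEllipticDescent.isSchottkyBasis hx hxy hA hfix (.inl h)
  · refine (NoEllipticDescent.isSchottkyBasis hy hxy ?_ (fun x hx => hfix x hx.symm)
      (.inl (semigroupGen_comm _ _ ▸ h))).swap
    rw [trace_mul_comm]
    exact hA.comm

/-! Attracting fixed points and the cross ratio -/

/-- In the eigenbasis the `n`-th power is `diag(l ^ n, l⁻¹ ^ n)`; the common factor `l ^ n` drops
out of homogeneous coordinates. -/
theorem ofMatrix_pow_smul {A : SL(2, ℝ)} {l p q r s : ℝ} (hl : l ≠ 0) (hD : p * s - q * r ≠ 0)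
    (h1 : A 0 0 * p + A 0 1 * r = l * p) (h2 : A 1 0 * p + A 1 1 * r = l * r)
    (h3 : A 0 0 * q + A 0 1 * s = l⁻¹ * q) (h4 : A 1 0 * q + A 1 1 * s = l⁻¹ * s)
    {a b : ℝ} (hab : a ≠ 0 ∨ b ≠ 0) (n : ℕ) :
    ofMatrix A ^ n • pt (a * p + b * q) (a * r + b * s) =
      pt (a * p + (l⁻¹ ^ 2) ^ n * b * q) (a * r + (l⁻¹ ^ 2) ^ n * b * s) := by
  induction n with
  | zero => simp
  | succ n ih =>
    set c := (l⁻¹ ^ 2) ^ n * b with hc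
    have hac : a ≠ 0 ∨ c ≠ 0 := by
      refine hab.imp_right fun hb => mul_ne_zero ?_ hb
      positivity
    have hne : a * p + c * q ≠ 0 ∨ a * r + c * s ≠ 0 := by
      by_contra! h
      have ha : a * (p * s - q * r) = 0 := by linear_combination s * h.1 - q * h.2
      have hc' : c * (p * s - q * r) = 0 := by linear_combination p * h.2 - r * h.1
      simp_all
    rw [pow_succ', mul_smul, ih, ofMatrix_smul_pt A hne, ← pt_mul hl (a * p + _)]
    congr 1
    · rw [pow_succ, hc]
      have : l * l⁻¹ ^ 2 = l⁻¹ := by field_simp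
      linear_combination a * h1 + (l⁻¹ ^ 2) ^ n * b * h3 - (l⁻¹ ^ 2) ^ n * b * q * this
    · rw [pow_succ, hc]
      have : l * l⁻¹ ^ 2 = l⁻¹ := by field_simp
      linear_combination a * h2 + (l⁻¹ ^ 2) ^ n * b * h4 - (l⁻¹ ^ 2) ^ n * b * s * this

/-- Iterates of every point except `pt q s` tend to `pt p r`, so `pt p r` is the only attracting
fixed point and the choice in `attr` must return it. -/
theorem attr_eq {A : SL(2, ℝ)} {l p q r s : ℝ} (hl : 1 < l) (hD : p * s - q * r ≠ 0)
    (h1 : A 0 0 * p + A 0 1 * r = l * p) (h2 : A 1 0 * p + A 1 1 * r = l * r)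
    (h3 : A 0 0 * q + A 0 1 * s = l⁻¹ * q) (h4 : A 1 0 * q + A 1 1 * s = l⁻¹ * s) :
    attr (ofMatrix A) = pt p r := by
  have hl0 : l ≠ 0 := by positivity
  have hpr : p ≠ 0 ∨ r ≠ 0 := by
    by_contra! h
    simp [h] at hD
  have hqs : q ≠ 0 ∨ s ≠ 0 := by
    by_contra! h
    simp [h] at hD
  have hlim : ∀ x, x ≠ pt q s → Tendsto (fun n : ℕ => ofMatrix A ^ n • x) atTop (𝓝 (pt p r)) := by
    intro x hx
    obtain ⟨u, v, huv, rfl⟩ := exists_pt x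
    obtain ⟨a, ha⟩ : ∃ a, a * (p * s - q * r) = u * s - v * q := ⟨_, div_mul_cancel₀ _ hD⟩
    obtain ⟨b, hb⟩ : ∃ b, b * (p * s - q * r) = p * v - r * u := ⟨_, div_mul_cancel₀ _ hD⟩
    have hu : u = a * p + b * q := mul_left_cancel₀ hD (by linear_combination -p * ha - q * hb)
    have hv : v = a * r + b * s := mul_left_cancel₀ hD (by linear_combination -r * ha - s * hb)
    have ha0 : a ≠ 0 := by
      rintro rfl
      apply hx
      rw [pt_eq_pt huv hqs]
      linarith
    have hlin : Tendsto (fun n : ℕ => (l⁻¹ ^ 2) ^ n) atTop (𝓝 0) := by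
      refine tendsto_pow_atTop_nhds_zero_of_lt_one (by positivity) ?_
      exact pow_lt_one₀ (by positivity) (inv_lt_one_of_one_lt₀ hl) two_ne_zero
    rw [hu, hv]
    simp only [ofMatrix_pow_smul hl0 hD h1 h2 h3 h4 (Or.inl ha0)]
    have := tendsto_pt (u := fun n : ℕ => a * p + (l⁻¹ ^ 2) ^ n * b * q)
      (v := fun n : ℕ => a * r + (l⁻¹ ^ 2) ^ n * b * s)
      (tendsto_const_nhds.add ((hlin.mul_const b).mul_const q))
      (tendsto_const_nhds.add ((hlin.mul_const b).mul_const s))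
      (by simpa [ha0] using hpr)
    simpa [pt_mul ha0] using this
  have hne : pt p r ≠ pt q s := by
    rw [ne_eq, pt_eq_pt hpr hqs]
    intro h
    apply hD
    linarith
  have hatt : IsAttractingFixedPoint (ofMatrix A) (pt p r) :=
    ⟨smul_pt_of_eigenvector hl0 hpr h1 h2, Filter.Eventually.mono (isOpen_ne.mem_nhds hne) hlim⟩
  have huniq : ∀ x, IsAttractingFixedPoint (ofMatrix A) x → x = pt p r := by
    rintro x ⟨hfix, hx⟩
    by_contra hxp
    by_cases hxq : x = pt q s
    · obtain ⟨y, hy, hyx⟩ := ((hx.filter_mono nhdsWithin_le_nhds).and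
        (self_mem_nhdsWithin : {x}ᶜ ∈ 𝓝[≠] x)).exists
      exact hxp (tendsto_nhds_unique hy (hlim y (hxq ▸ hyx)))
    · have hpow : ∀ n : ℕ, ofMatrix A ^ n • x = x := fun n => by
        induction n with
        | zero => simp
        | succ n ih => rw [pow_succ, mul_smul, hfix, ih]
      have := hlim x hxq
      simp only [hpow] at this
      exact hxp (tendsto_nhds_unique tendsto_const_nhds this)
  exact huniq _ (Classical.epsilon_spec (p := fun p => IsAttractingFixedPoint (ofMatrix A) p)
    ⟨_, hatt⟩)

theorem rep_eq {A : SL(2, ℝ)} {l p q r s : ℝ} (hl : 1 < l) (hD : p * s - q * r ≠ 0)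
    (h1 : A 0 0 * p + A 0 1 * r = l * p) (h2 : A 1 0 * p + A 1 1 * r = l * r)
    (h3 : A 0 0 * q + A 0 1 * s = l⁻¹ * q) (h4 : A 1 0 * q + A 1 1 * s = l⁻¹ * s) :
    rep (ofMatrix A) = pt q s := by
  have hl0 : l ≠ 0 := by positivity
  have hd := det_eq_one A
  have hi : l * l⁻¹ = 1 := mul_inv_cancel₀ hl0
  have e : rep (ofMatrix A) = attr (ofMatrix A⁻¹) := rfl
  rw [e]
  refine attr_eq (q := p) (s := r) hl (fun h => hD (by linarith)) ?_ ?_ ?_ ?_ <;>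
    simp [Matrix.adjugate_fin_two]
  · linear_combination l * q * hd - l * A 1 1 * h3 + l * A 0 1 * h4 -
      (A 1 1 * q - A 0 1 * s) * hi
  · linear_combination l * s * hd + l * A 1 0 * h3 - l * A 0 0 * h4 - (A 0 0 * s - A 1 0 * q) * hi
  · linear_combination l⁻¹ * p * hd - l⁻¹ * A 1 1 * h1 + l⁻¹ * A 0 1 * h2 -
      (A 1 1 * p - A 0 1 * r) * hi
  · linear_combination l⁻¹ * r * hd + l⁻¹ * A 1 0 * h1 - l⁻¹ * A 0 0 * h2 -
      (A 0 0 * r - A 1 0 * p) * hi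

/-- The normalising denominators cancel in the cross ratio, leaving determinants of eigenvectors. -/
theorem homDiff_pt {a b c d : ℝ} (h : a ≠ 0 ∨ b ≠ 0) (h' : c ≠ 0 ∨ d ≠ 0) :
    homDiff (pt a b) (pt c d) =
      (a * d - b * c) / ((if b = 0 then a else b) * (if d = 0 then c else d)) := by
  have hinf : ∀ y : ℝ, homDiff ∞ (y : OnePoint ℝ) = 1 := fun _ => rfl
  have hinf' : ∀ y : ℝ, homDiff (y : OnePoint ℝ) ∞ = -1 := fun _ => rfl
  have hinf'' : homDiff ∞ ∞ = 0 := rfl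
  have hcoe : ∀ x y : ℝ, homDiff (x : OnePoint ℝ) (y : OnePoint ℝ) = x - y := fun _ _ => rfl
  by_cases hb : b = 0 <;> by_cases hd : d = 0
  · simp [pt, hb, hd, hinf'']
  · have ha : a ≠ 0 := by simpa [hb] using h
    simp [pt, hb, hd, ha, hinf]
  · have hc : c ≠ 0 := by simpa [hd] using h'
    simp [pt, hb, hd, hc, hinf']
  · simp only [pt, hb, hd, if_false, hcoe]
    field_simp

theorem IsNormalForm.crossRatio_eq {F G : SL(2, ℝ)} {K : GL (Fin 2) ℝ} {l m k : ℝ}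
    (h : IsNormalForm F G K l m k) (hl : 1 < l) (hm : 1 < m) :
    crossRatio (ofMatrix F) (ofMatrix G) = 1 - (l - l⁻¹) * (m - m⁻¹) / k := by
  have hl0 := h.left_ne_zero
  have hm0 := h.right_ne_zero
  have hk := h.ne_zero
  have hK : K 0 0 * K 1 1 - K 0 1 * K 1 0 ≠ 0 := by
    have := K.det_ne_zero
    rwa [Matrix.det_fin_two] at this
  have hL : l - l⁻¹ ≠ 0 := (sub_pos.2 ((inv_lt_one_of_one_lt₀ hl).trans hl)).ne'
  have hM : m - m⁻¹ ≠ 0 := (sub_pos.2 ((inv_lt_one_of_one_lt₀ hm).trans hm)).ne'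
  have hF := fun i j => congrFun (congrFun h.left_eq i) j
  have hG := fun i j => congrFun (congrFun h.right_eq i) j
  simp only [Matrix.mul_apply, Fin.sum_univ_two] at hF hG
  have f00 := hF 0 0
  have f01 := hF 0 1
  have f10 := hF 1 0
  have f11 := hF 1 1
  have g00 := hG 0 0
  have g01 := hG 0 1
  have g10 := hG 1 0
  have g11 := hG 1 1
  simp at f00 f01 f10 f11 g00 g01 g10 g11
  clear hF hG
  obtain ⟨a, b, c, d, ha, hb, hc, hd⟩ : ∃ a b c d, K 0 0 = a ∧ K 0 1 = b ∧ K 1 0 = c ∧ K 1 1 = d :=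
    ⟨_, _, _, _, rfl, rfl, rfl, rfl⟩
  rw [ha, hb, hc, hd] at hK
  simp only [ha, hb, hc, hd] at f00 f01 f10 f11 g00 g01 g10 g11
  -- The other eigenvectors of the triangular models are `(-1, l - l⁻¹)` and `(m - m⁻¹, -k)`; `(q,
  -- s)` and `(u, v)` are their images under `K`.
  set q := -a + (l - l⁻¹) * b with hq
  set s := -c + (l - l⁻¹) * d with hs
  set u := (m - m⁻¹) * a - k * b with hu
  set v := (m - m⁻¹) * c - k * d with hv
  have hll : l * l⁻¹ = 1 := mul_inv_cancel₀ hl0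
  have hmm : m * m⁻¹ = 1 := mul_inv_cancel₀ hm0
  have hD1 : a * s - q * c ≠ 0 := by
    have : a * s - q * c = (l - l⁻¹) * (a * d - b * c) := by rw [hq, hs]; ring
    rw [this]
    exact mul_ne_zero hL hK
  have hD2 : b * v - u * d ≠ 0 := by
    have : b * v - u * d = -((m - m⁻¹) * (a * d - b * c)) := by rw [hu, hv]; ring
    rw [this]
    exact neg_ne_zero.2 (mul_ne_zero hM hK)
  have F1 : F 0 0 * a + F 0 1 * c = l * a := by linarith
  have F2 : F 1 0 * a + F 1 1 * c = l * c := by linarith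
  have F3 : F 0 0 * q + F 0 1 * s = l⁻¹ * q := by
    rw [hq, hs]; linear_combination (l - l⁻¹) * f01 - f00
  have F4 : F 1 0 * q + F 1 1 * s = l⁻¹ * s := by
    rw [hq, hs]; linear_combination (l - l⁻¹) * f11 - f10
  have G1 : G 0 0 * b + G 0 1 * d = m * b := by linarith
  have G2 : G 1 0 * b + G 1 1 * d = m * d := by linarith
  have G3 : G 0 0 * u + G 0 1 * v = m⁻¹ * u := by
    rw [hu, hv]; linear_combination (m - m⁻¹) * g00 - k * g01
  have G4 : G 1 0 * u + G 1 1 * v = m⁻¹ * v := by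
    rw [hu, hv]; linear_combination (m - m⁻¹) * g10 - k * g11
  have nz : ∀ {x y z w : ℝ}, x * w - z * y ≠ 0 → (x ≠ 0 ∨ y ≠ 0) ∧ (z ≠ 0 ∨ w ≠ 0) := by
    intro x y z w hne
    constructor <;> by_contra! h0 <;> simp [h0] at hne
  have nn : ∀ {x y : ℝ}, (x ≠ 0 ∨ y ≠ 0) → (if y = 0 then x else y) ≠ 0 := by
    intro x y hxy
    split_ifs with hy
    · simpa [hy] using hxy
    · exact hy
  obtain ⟨n1, n2⟩ := nz hD1
  obtain ⟨n3, n4⟩ := nz hD2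
  rw [crossRatio, attr_eq hl hD1 F1 F2 F3 F4, rep_eq hl hD1 F1 F2 F3 F4,
    attr_eq hm hD2 G1 G2 G3 G4, rep_eq hm hD2 G1 G2 G3 G4, homDiff_pt n1 n3, homDiff_pt n2 n4,
    homDiff_pt n1 n4, homDiff_pt n2 n3]
  have e1 : a * v - c * u = -(k * (a * d - b * c)) := by rw [hu, hv]; ring
  have e2 : q * d - s * b = -(a * d - b * c) := by rw [hq, hs]; ring
  have e3 : q * v - s * u = (k - (l - l⁻¹) * (m - m⁻¹)) * (a * d - b * c) := by
    rw [hu, hv, hq, hs]; ring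
  have e4 : a * d - c * b = a * d - b * c := by ring
  rw [e1, e2, e3, e4]
  have := nn n1
  have := nn n2
  have := nn n3
  have := nn n4
  generalize (if c = 0 then a else c) = N1 at *
  generalize (if s = 0 then q else s) = N2 at *
  generalize (if d = 0 then b else d) = N3 at *
  generalize (if v = 0 then u else v) = N4 at *
  generalize l - l⁻¹ = L at *
  generalize m - m⁻¹ = M at *
  field_simp

/-! The classification -/

theorem isSchottkyBasis_of_one_notMem_closure_mul {F G : SL(2, ℝ)} (hx : 2 ≤ F 0 0 + F 1 1)
    (hxy : F 0 0 + F 1 1 ≤ G 0 0 + G 1 1) (hz : 2 ≤ (F * G) 0 0 + (F * G) 1 1)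
    (hA : Antiparallel (F 0 0 + F 1 1) (G 0 0 + G 1 1) ((F * G) 0 0 + (F * G) 1 1))
    (hfix : ∀ x : OnePoint ℝ, ¬ (ofMatrix F • x = x ∧ ofMatrix G • x = x))
    (h : (1 : Mob) ∉ closure (semigroupGen (ofMatrix F) (ofMatrix F * ofMatrix G) : Set Mob)) :
    IsSchottkyBasis (ofMatrix F) (ofMatrix G) := by
  have e : ofMatrix F * ofMatrix G = ofMatrix (F * G) := rfl
  rw [e] at h
  refine IsSchottkyBasis.of_mul_right ?_
  rw [e]
  refine isSchottkyBasis_of_one_notMem_closure hx hz ?_ (not_fixed_mul hfix) h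
  rw [trace_mul_mul]
  exact hA.mul hx hxy hz

theorem not_fixed_of_not_isElementary {f g : Mob} (h : ¬ IsElementary (semigroupGen f g))
    (x : OnePoint ℝ) : ¬ (f • x = x ∧ g • x = x) := by
  rintro ⟨hf, hg⟩
  refine h (.inr ⟨x, (Set.finite_singleton x).subset ?_⟩)
  rintro _ ⟨k, hk, rfl⟩
  have : semigroupGen f g ≤ (MulAction.stabilizer Mob x).toSubmonoid.toSubsemigroup := by
    rw [semigroupGen, Subsemigroup.closure_le]
    rintro _ (rfl | rfl)
    exacts [hf, hg]
  exact this hk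

theorem IsNormalForm.ne_one {F G : SL(2, ℝ)} {K : GL (Fin 2) ℝ} {l m k : ℝ}
    (h : IsNormalForm F G K l m k) : ofMatrix F ≠ 1 ∧ ofMatrix G ≠ 1 := by
  constructor <;> intro h1
  · have := h.smul_left ((0 : ℝ) : OnePoint ℝ)
    rw [h1, one_smul, upper_smul_coe] at this
    have := MulAction.injective K this
    rw [OnePoint.coe_eq_coe] at this
    exact h.left_ne_zero (by linarith)
  · have := h.smul_right (∞ : OnePoint ℝ)
    rw [h1, one_smul, lower_smul_infty _ _ _ h.ne_zero] at this
    exact OnePoint.coe_ne_infty _ (MulAction.injective K this)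

theorem IsNormalForm.crossRatio_lt_one_iff {F G : SL(2, ℝ)} {K : GL (Fin 2) ℝ} {l m k : ℝ}
    (h : IsNormalForm F G K l m k) (hF : 2 < F 0 0 + F 1 1) (hG : 2 < G 0 0 + G 1 1) :
    (crossRatio (ofMatrix F) (ofMatrix G) < 1 ↔ 0 < k) ∧
      (1 < crossRatio (ofMatrix F) (ofMatrix G) ↔ k < 0) := by
  have one_lt : ∀ {t : ℝ}, 1 ≤ t → 2 < t + t⁻¹ → 1 < t := by
    intro t ht h2
    refine lt_of_le_of_ne ht ?_
    rintro rfl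
    norm_num at h2
  have hl := one_lt h.one_le_left (h.trace_left ▸ hF)
  have hm := one_lt h.one_le_right (h.trace_right ▸ hG)
  have hL : 0 < (l - l⁻¹) * (m - m⁻¹) :=
    mul_pos (sub_pos.2 ((inv_lt_one_of_one_lt₀ hl).trans hl))
      (sub_pos.2 ((inv_lt_one_of_one_lt₀ hm).trans hm))
  rw [h.crossRatio_eq hl hm]
  constructor
  · rw [sub_lt_self_iff, div_pos_iff_of_pos_left hL]
  · rw [lt_sub_comm, sub_self, div_neg_iff]
    constructor
    · rintro (h | h)
      · exact h.2
      · linarith [h.1]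
    · intro h
      exact .inl ⟨hL, h⟩

/-- For an antiparallel pair with `z ≥ 2` this excludes alternative (a) of the third class, leaving
(b). -/
theorem commutatorTrace_lt {x y z : ℝ} (hx : 2 < x) (hxy : x ≤ y) (hz : 2 ≤ z)
    (h : 2 * z < x * y) : commutatorTrace x y z + 2 < y ^ 2 - 2 := by
  have h1 : 0 ≤ (z - 2) * (x * y - 2 * z) := mul_nonneg (by linarith) (by linarith)
  unfold commutatorTrace
  nlinarith

theorem ClassOne.tr_eq {f g : Mob} (h : ClassOne f g) : tr f = 2 ∧ tr g = 2 :=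
  ⟨(isParabolic_iff.1 h.1).2, (isParabolic_iff.1 h.2.1).2⟩

theorem ClassTwo.tr_eq {f g : Mob} (h : ClassTwo f g) : tr f = 2 ∧ 2 < tr g :=
  ⟨(isParabolic_iff.1 h.1).2, isHyperbolic_iff.1 h.2.1⟩

theorem ClassThree.two_lt_tr {f g : Mob} (h : ClassThree f g) : 2 < tr f := isHyperbolic_iff.1 h.1

/-- The traces of `f` and `g` already separate the three classes, so only one of them is ever in
question. -/
theorem exactlyOne_iff_classOne {f g : Mob} (hf : f ≠ 1) (hg : g ≠ 1) (hx : tr f = 2)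
    (hy : tr g = 2) : ExactlyOne (ClassOne f g) (ClassTwo f g) (ClassThree f g) ↔
      ¬ IsElliptic (f * g) := by
  have h2 : ¬ ClassTwo f g := fun h => h.tr_eq.2.ne' hy
  have h3 : ¬ ClassThree f g := fun h => h.two_lt_tr.ne' hx
  simp [ExactlyOne, h2, h3, ClassOne, isParabolic_iff, hf, hg, hx, hy]

theorem exactlyOne_iff_classTwo {f g : Mob} (hf : f ≠ 1) (hx : tr f = 2) (hy : 2 < tr g) :
    ExactlyOne (ClassOne f g) (ClassTwo f g) (ClassThree f g) ↔
      ∀ n : ℕ, 0 < n → ¬ IsElliptic (f ^ n * g) := by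
  have h1 : ¬ ClassOne f g := fun h => hy.ne' h.tr_eq.2
  have h3 : ¬ ClassThree f g := fun h => h.two_lt_tr.ne' hx
  simp [ExactlyOne, h1, h3, ClassTwo, isParabolic_iff, isHyperbolic_iff, hf, hx, hy]

theorem exactlyOne_iff_classThree {f g : Mob} (hx : 2 < tr f) :
    ExactlyOne (ClassOne f g) (ClassTwo f g) (ClassThree f g) ↔ ClassThree f g := by
  have h1 : ¬ ClassOne f g := fun h => hx.ne' h.tr_eq.1
  have h2 : ¬ ClassTwo f g := fun h => hx.ne' h.tr_eq.1
  simp [ExactlyOne, h1, h2]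

theorem classification_of_normalForm {F G : SL(2, ℝ)} {K : GL (Fin 2) ℝ} {l m k : ℝ}
    (h : IsNormalForm F G K l m k) (hF : F 0 0 + F 1 1 = tr (ofMatrix F))
    (hG : G 0 0 + G 1 1 = tr (ofMatrix G)) (hx : 2 ≤ tr (ofMatrix F))
    (hxy : tr (ofMatrix F) ≤ tr (ofMatrix G))
    (hfix : ∀ x : OnePoint ℝ, ¬ (ofMatrix F • x = x ∧ ofMatrix G • x = x)) :
    (1 : Mob) ∉ closure (semigroupGen (ofMatrix F) (ofMatrix G) : Set Mob) ↔
      ExactlyOne (ClassOne (ofMatrix F) (ofMatrix G)) (ClassTwo (ofMatrix F) (ofMatrix G))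
        (ClassThree (ofMatrix F) (ofMatrix G)) := by
  set z := (F * G) 0 0 + (F * G) 1 1 with hz
  have hell : (1 : Mob) ∉ closure (semigroupGen (ofMatrix F) (ofMatrix G) : Set Mob) →
      ∀ n : ℕ, ¬ IsElliptic (ofMatrix F ^ n * ofMatrix G) := by
    intro h1 n he
    refine h1 (one_mem_closure_of_isElliptic ?_ he)
    rcases eq_or_ne n 0 with rfl | hn
    · simpa using right_mem_semigroupGen _ _
    · exact mul_mem (pow_mem_subsemigroup (left_mem_semigroupGen _ _) hn)
        (right_mem_semigroupGen _ _)
  have hell1 : (1 : Mob) ∉ closure (semigroupGen (ofMatrix F) (ofMatrix G) : Set Mob) →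
      ¬ IsElliptic (ofMatrix F * ofMatrix G) := fun h1 => by simpa using hell h1 1
  have hzell : ¬ IsElliptic (ofMatrix F * ofMatrix G) → 2 ≤ z ∨ z ≤ -2 := by
    intro he
    rw [isElliptic_iff, not_lt] at he
    have he' : 2 ≤ |z| := (tr_ofMatrix' (F * G)) ▸ he
    exact (le_abs.1 he').imp_right fun h => by linarith
  have hpos : 0 < k → (1 : Mob) ∉ closure (semigroupGen (ofMatrix F) (ofMatrix G) : Set Mob) := by
    intro hk
    obtain ⟨J, hJ, hJF, hJG⟩ := h.exists_closedInterval hk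
    exact one_notMem_closure_of_mapsStrictlyInside hJ.1 hJF hJG
  rcases hx.eq_or_lt with hx2 | hx2
  · rcases (hx.trans hxy).eq_or_lt with hy2 | hy2
    · rw [exactlyOne_iff_classOne h.ne_one.1 h.ne_one.2 hx2.symm hy2.symm]
      refine ⟨hell1, fun he => ?_⟩
      rcases lt_or_gt_of_ne h.ne_zero with hk | hk
      -- With both traces `2`, the antiparallel condition gives `2 * z < 4`, so only `z ≤ -2`
      -- remains and no descent is needed.
      · refine (h.isSchottkyBasis hk ((hzell he).resolve_left fun hz2 => ?_)).2.one_notMem_closure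
        have := (h.neg_iff.1 hk).1
        rw [hF, hG, ← hx2, ← hy2, ← hz] at this
        linarith
      · exact hpos hk
    · rw [exactlyOne_iff_classTwo h.ne_one.1 hx2.symm hy2]
      refine ⟨fun h1 n _ => hell h1 n, fun he => ?_⟩
      rcases lt_or_gt_of_ne h.ne_zero with hk | hk
      · exact (NoEllipticDescent.isSchottkyBasis (by rwa [hF]) (by rwa [hF, hG]) (h.neg_iff.1 hk)
          hfix (.inr ⟨hx2.symm, he⟩)).2.one_notMem_closure
      · exact hpos hk
  · have hy2 := hx2.trans_le hxy
    obtain ⟨hc1, hc2⟩ := h.crossRatio_lt_one_iff (by rwa [hF]) (by rwa [hG])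
    rw [exactlyOne_iff_classThree hx2, ClassThree, isHyperbolic_iff, isHyperbolic_iff, hc1, hc2,
      semidiscrete_inverseFree_iff, and_iff_right hx2, and_iff_right hy2]
    rcases lt_or_gt_of_ne h.ne_zero with hk | hk
    · rw [or_iff_right hk.not_gt, and_iff_right hk]
      have hA := h.neg_iff.1 hk
      have hcomm : tr (ofMatrix F * ofMatrix G * (ofMatrix F)⁻¹ * (ofMatrix G)⁻¹) =
          commutatorTrace (F 0 0 + F 1 1) (G 0 0 + G 1 1) z + 2 := by
        rw [tr_commutator, abs_of_pos]
        linarith [hA.2]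
      rw [hcomm]
      constructor
      · intro h1
        refine ⟨hell1 h1, ?_⟩
        refine (le_or_gt _ _).imp_right fun h' => ⟨h', fun h2 => h1 ?_⟩
        exact closure_mono (semigroupGen_mul_le _ _) h2
      · rintro ⟨he, hor⟩
        rcases hzell he with hz2 | hz2
        · have hlt := commutatorTrace_lt (by rwa [hF]) (by rwa [hF, hG]) hz2 hA.1
          rw [hG] at hlt hor
          exact (isSchottkyBasis_of_one_notMem_closure_mul (by rwa [hF]) (by rwa [hF, hG]) hz2 hA
            hfix (hor.resolve_left (not_le.2 hlt)).2).2.one_notMem_closure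
        · exact (h.isSchottkyBasis hk hz2).2.one_notMem_closure
    · exact iff_of_true (hpos hk) (.inl hk)

theorem not_exactlyOne_of_tr_lt {f g : Mob} (hf : tr f < 2) :
    ¬ ExactlyOne (ClassOne f g) (ClassTwo f g) (ClassThree f g) := by
  rintro (⟨h, -⟩ | ⟨-, h, -⟩ | ⟨-, -, h⟩)
  · exact hf.ne h.tr_eq.1
  · exact hf.ne h.tr_eq.1
  · exact hf.not_gt h.two_lt_tr

end RealMobius

open RealMobius in
theorem theorem1p2 (f g : RealMobius.Mob) (htr : RealMobius.tr f ≤ RealMobius.tr g)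
    (hne : ¬ RealMobius.IsElementary (RealMobius.semigroupGen f g)) :
    ((RealMobius.IsSemidiscrete (RealMobius.semigroupGen f g) ∧
        RealMobius.IsInverseFree (RealMobius.semigroupGen f g)) ↔
      RealMobius.ExactlyOne (RealMobius.ClassOne f g) (RealMobius.ClassTwo f g)
        (RealMobius.ClassThree f g)) ∧
    (RealMobius.IsSemidiscrete (RealMobius.semigroupGen f g) →
      RealMobius.IsInverseFree (RealMobius.semigroupGen f g) →
      (∃ J : Set (OnePoint ℝ), RealMobius.IsClosedInterval J ∧
        RealMobius.MapsStrictlyInside f J ∧ RealMobius.MapsStrictlyInside g J) ∨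
      ∃ G : Subgroup RealMobius.Mob, RealMobius.IsSchottkyRankTwo G ∧
        (RealMobius.semigroupGen f g : Set RealMobius.Mob) ⊆ (G : Set RealMobius.Mob)) := by
  have hfix := not_fixed_of_not_isElementary hne
  rcases lt_or_ge (tr f) 2 with hf2 | hf2
  -- An elliptic `f` fails both sides, since every class requires `tr f ≥ 2`.
  · have hbad : ¬ (IsSemidiscrete (semigroupGen f g) ∧ IsInverseFree (semigroupGen f g)) := by
      rw [semidiscrete_inverseFree_iff, not_not]
      exact one_mem_closure_of_isElliptic (left_mem_semigroupGen f g) (isElliptic_iff.2 hf2)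
    exact ⟨iff_of_false hbad (not_exactlyOne_of_tr_lt hf2), fun h1 h2 => absurd ⟨h1, h2⟩ hbad⟩
  · obtain ⟨F, rfl, hF⟩ := exists_lift f
    obtain ⟨G, rfl, hG⟩ := exists_lift g
    obtain ⟨K, l, m, k, h⟩ := exists_normalForm F G (by rwa [hF]) (by rw [hG]; linarith) hfix
    refine ⟨(semidiscrete_inverseFree_iff _).trans
      (classification_of_normalForm h hF hG hf2 htr hfix), fun h1 h2 => ?_⟩
    have hgood := (semidiscrete_inverseFree_iff _).1 ⟨h1, h2⟩
    rcases lt_or_gt_of_ne h.ne_zero with hk | hk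
    · exact .inr ⟨_, (isSchottkyBasis_of_one_notMem_closure (by rwa [hF]) (by rw [hG]; linarith)
        (h.neg_iff.1 hk) hfix hgood).1, semigroupGen_subset_closure _ _⟩
    · exact .inl (h.exists_closedInterval hk)
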